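/- Let $R$ be an integral domain (for example $\mathbb{Z}$ or $\mathbb{Q}$), let $n$ be a positive integer, and let $a,b,c,d,x_1,\dots,x_{2n}$ be indeterminates. For a partition $\lambda=(\lambda_1\ge\lambda_2\ge\cdots)$ with $\ell(\lambda)$ non-zero parts put $$\omega(\lambda)=a^{\sum_{i\ge1}\lceil\lambda_{2i-1}/2\rceil}\,b^{\sum_{i\ge1}\lfloor\lambda_{2i-1}/2\rfloor}\,c^{\sum_{i\ge1}\lceil\lambda_{2i}/2\rceil}\,d^{\sum_{i\ge1}\lfloor\lambda_{2i}/2\rfloor},$$ and, if $\ell(\lambda)\le 2n$, let $$s_\lambda(x_1,\dots,x_{2n})=\frac{\det\bigl(x_i^{\lambda_j+2n-j}\bigr)_{1\le i,j\le 2n}}{\prod_{1\le i<j\le 2n}(x_i-x_j)}$$ be the Schur polynomial. Then the family $\bigl(\omega(\lambda)s_\lambda(x_1,\dots,x_{2n})\bigr)_{\ell(\lambda)\le2n}$ is summable in the formal power series ring $R[a,b,c,d][[x_1,\dots,x_{2n}]]$ (each monomial in the $x_i$ has a non-zero coefficient in only finitely many members), and its sum $$z_n=\sum_{\ell(\lambda)\le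 2n}\omega(\lambda)\,s_\lambda(x_1,\dots,x_{2n})$$ satisfies, in the field of fractions of that ring, $$z_n=\frac{(abcd)^{-\binom n2}}{\prod_{1\le i<j\le 2n}(x_i-x_j)}\;\operatorname{Pf}\bigl(p_{ij}\bigr)_{1\le i,j\le 2n},$$ where $$p_{ij}=\frac{\begin{vmatrix}x_i+ax_i^2&1-a(b+c)x_i^2-abc\,x_i^3\\ x_j+ax_j^2&1-a(b+c)x_j^2-abc\,x_j^3\end{vmatrix}}{(1-abx_i^2)(1-abx_j^2)(1-abcd\,x_i^2x_j^2)}.$$ Here the Pfaffian of a skew-symmetric matrix $A=(a_{ij})_{1\le i,j\le 2n}$ is $$\operatorname{Pf}(A)=\sum\epsilon(\sigma_1,\dots,\sigma_{2n})\,a_{\sigma_1\sigma_2}\cdots a_{\sigma_{2n-1}\sigma_{2n}},$$ the sum being over all partitions $\{\{\sigma_1<\sigma_2\},\dots,\{\sigma_{2n-1}<\sigma_{2n}\}\}$ of $\{1,\dots,2n\}$ into two-element blocks, where $\epsilon(\sigma_1,\dots,\sigma_{2n})$ is the sign of the permutation $k\mapsto\sigma_k$. -/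

import Mathlib

noncomputable section

namespace StanleySchur

/-! ### Schur polynomials -/

/-- The alternant `a_{μ+δ} = det (x_i ^ (μ_j + m - j))_{1 ≤ i, j ≤ m}` in `m` variables
(rows and columns are numbered from `0` here; `μ.rowLen j` is the `j`-th part of `μ`). -/
def alternant (R : Type*) [CommRing R] (m : ℕ) (μ : YoungDiagram) : MvPolynomial (Fin m) R :=
  Matrix.det (Matrix.of fun i j : Fin m =>
    (MvPolynomial.X i : MvPolynomial (Fin m) R) ^ (μ.rowLen j + (m - 1 - (j : ℕ))))

/-- The difference product `a_δ = ∏_{i < j} (x_i - x_j)`. -/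
def diffProd {S : Type*} [CommRing S] {m : ℕ} (x : Fin m → S) : S :=
  ∏ i : Fin m, ∏ j ∈ Finset.Ioi i, (x i - x j)

theorem X_sub_X_irreducible {m : ℕ} {i j : Fin m} (h : i ≠ j) :
    Irreducible (MvPolynomial.X i - MvPolynomial.X j : MvPolynomial (Fin m) ℤ) := by
  have key := MvPolynomial.irreducible_sumSMulX (R := ℤ)
    (Finsupp.single i 1 - Finsupp.single j 1 : Fin m →₀ ℤ)
    ⟨i, by simp [h.symm]⟩
    (fun r hr => by
      have := hr i
      simp [h.symm] at this
      exact isUnit_of_dvd_one this)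
  simpa [MvPolynomial.sumSMulX] using key

theorem X_sub_X_not_dvd {m : ℕ} {i j k l : Fin m} (hij : i < j) (hkl : k < l)
    (hne : (i, j) ≠ (k, l)) :
    ¬ (MvPolynomial.X i - MvPolynomial.X j : MvPolynomial (Fin m) ℤ) ∣
      MvPolynomial.X k - MvPolynomial.X l := by
  rintro ⟨q, hq⟩
  have h := congrArg (MvPolynomial.eval
    (fun t : Fin m => if t = i ∨ t = j then (0 : ℤ) else (t : ℕ) + 1)) hq
  simp only [map_sub, map_mul, MvPolynomial.eval_X] at h
  simp only [true_or, or_true, if_true, sub_self, zero_mul] at h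
  have hne' : ¬ (i = k ∧ j = l) := by simpa using hne
  split_ifs at h <;> grind

theorem X_sub_X_dvd_alternant {m : ℕ} (μ : YoungDiagram) {i j : Fin m} (h : i ≠ j) :
    (MvPolynomial.X i - MvPolynomial.X j : MvPolynomial (Fin m) ℤ) ∣ alternant ℤ m μ := by
  rw [← Ideal.mem_span_singleton, ← Ideal.Quotient.eq_zero_iff_mem, alternant, RingHom.map_det]
  refine Matrix.det_zero_of_row_eq h ?_
  funext k
  have : (Ideal.Quotient.mk (Ideal.span
      {(MvPolynomial.X i - MvPolynomial.X j : MvPolynomial (Fin m) ℤ)})) (MvPolynomial.X i) =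
      (Ideal.Quotient.mk _) (MvPolynomial.X j) :=
    Ideal.Quotient.eq.2 (Ideal.mem_span_singleton_self _)
  simp [this]

theorem diffProd_dvd_alternant (R : Type*) [CommRing R] (m : ℕ) (μ : YoungDiagram) :
    diffProd (MvPolynomial.X : Fin m → MvPolynomial (Fin m) R) ∣ alternant R m μ := by
  have hZ : diffProd (MvPolynomial.X : Fin m → MvPolynomial (Fin m) ℤ) ∣ alternant ℤ m μ := by
    rw [diffProd, Finset.prod_sigma']
    refine Finset.prod_dvd_of_isRelPrime ?_ ?_
    · rintro ⟨i, j⟩ hij ⟨k, l⟩ hkl hne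
      simp only [Finset.coe_sigma, Set.mem_sigma_iff, Finset.coe_univ, Set.mem_univ, true_and,
        Finset.coe_Ioi, Set.mem_Ioi] at hij hkl
      exact (X_sub_X_irreducible hij.ne).isRelPrime_iff_not_dvd.2
        (X_sub_X_not_dvd hij hkl (fun h => hne (by cases h; rfl)))
    · rintro ⟨i, j⟩ hij
      simp only [Finset.mem_sigma, Finset.mem_univ, true_and, Finset.mem_Ioi] at hij
      exact X_sub_X_dvd_alternant μ hij.ne
  have h := map_dvd (MvPolynomial.map (σ := Fin m) (Int.castRingHom R)) hZ
  simpa [diffProd, alternant, RingHom.map_det, map_prod, RingHom.mapMatrix_apply, Matrix.map,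
    Matrix.of_apply] using h

open Classical in
/-- The Schur polynomial `s_μ(x_1, …, x_m) = a_{μ+δ} / a_δ`, the quotient of the alternant by the
difference product in the polynomial ring; it is `0` if `μ` has more than `m` parts. -/
def schur (R : Type*) [CommRing R] (m : ℕ) (μ : YoungDiagram) : MvPolynomial (Fin m) R :=
  if μ.colLen 0 ≤ m then (diffProd_dvd_alternant R m μ).choose else 0

/-- The property characterising the Schur polynomial (`a_δ` is not a zero divisor). -/
theorem diffProd_mul_schur (R : Type*) [CommRing R] (m : ℕ) (μ : YoungDiagram)
    (h : μ.colLen 0 ≤ m) :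
    diffProd (MvPolynomial.X : Fin m → MvPolynomial (Fin m) R) * schur R m μ =
      alternant R m μ := by
  rw [schur, if_pos h]
  exact (diffProd_dvd_alternant R m μ).choose_spec.symm

/-! ### Stanley's weight -/

/-- Stanley's weight `ω(μ)`. With rows numbered from `0`, the odd-indexed parts
`μ_1, μ_3, …` are `μ.rowLen (2 * i)` and the even-indexed parts are `μ.rowLen (2 * i + 1)`;
`(k + 1) / 2` and `k / 2` in `ℕ` are `⌈k / 2⌉` and `⌊k / 2⌋`, and the omitted parts are zero. -/
def omega {S : Type*} [CommRing S] (a b c d : S) (μ : YoungDiagram) : S :=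
  a ^ (∑ i ∈ Finset.range (μ.colLen 0), (μ.rowLen (2 * i) + 1) / 2) *
  b ^ (∑ i ∈ Finset.range (μ.colLen 0), μ.rowLen (2 * i) / 2) *
  c ^ (∑ i ∈ Finset.range (μ.colLen 0), (μ.rowLen (2 * i + 1) + 1) / 2) *
  d ^ (∑ i ∈ Finset.range (μ.colLen 0), μ.rowLen (2 * i + 1) / 2)

/-! ### Pfaffians -/

/-- The first element `σ_{2i-1}` of the `i`-th block, as a position (from `0`) in `Fin (2 * n)`. -/
def fstPos {n : ℕ} (i : Fin n) : Fin (2 * n) := ⟨2 * i, by omega⟩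

/-- The second element `σ_{2i}` of the `i`-th block, as a position (from `0`) in `Fin (2 * n)`. -/
def sndPos {n : ℕ} (i : Fin n) : Fin (2 * n) := ⟨2 * i + 1, by omega⟩

/-- The permutations that list a perfect matching `{σ_1 < σ_2}, …, {σ_{2n-1} < σ_{2n}}` of
`Fin (2 * n)` block by block, the blocks being ordered by their smaller elements. Each perfect
matching is listed by exactly one of them. -/
def IsMatchingPerm {n : ℕ} (σ : Equiv.Perm (Fin (2 * n))) : Prop :=
  (∀ i : Fin n, σ (fstPos i) < σ (sndPos i)) ∧
  ∀ i j : Fin n, i < j → σ (fstPos i) < σ (fstPos j)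

open Classical in
/-- The Pfaffian of a skew-symmetric `2n × 2n` matrix: the signed sum over perfect matchings. -/
def pfaffian {S : Type*} [CommRing S] {n : ℕ} (A : Matrix (Fin (2 * n)) (Fin (2 * n)) S) : S :=
  ∑ σ : Equiv.Perm (Fin (2 * n)) with IsMatchingPerm σ,
    ((Equiv.Perm.sign σ : ℤ) : S) * ∏ i : Fin n, A (σ (fstPos i)) (σ (sndPos i))

/-- The entry `p_ij` as a function of `x = x_i` and `y = x_j`. -/
def pEntry {F : Type*} [Field F] (a b c d x y : F) : F :=
  Matrix.det !![x + a * x ^ 2, 1 - a * (b + c) * x ^ 2 - a * b * c * x ^ 3;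
                y + a * y ^ 2, 1 - a * (b + c) * y ^ 2 - a * b * c * y ^ 3] /
    ((1 - a * b * x ^ 2) * (1 - a * b * y ^ 2) * (1 - a * b * c * d * x ^ 2 * y ^ 2))

/-! ### The rings of indeterminates and the sum of Schur polynomials -/

/-- The polynomial ring `R[a, b, c, d]`. -/
abbrev Coeffs (R : Type*) [CommRing R] := MvPolynomial (Fin 4) R

/-- The power series ring `R[a, b, c, d][[x_1, …, x_m]]`. -/
abbrev Series (R : Type*) [CommRing R] (m : ℕ) := MvPowerSeries (Fin m) (Coeffs R)

/-- The term `ω(μ) s_μ(x_1, …, x_m)` as an element of `R[a, b, c, d][[x_1, …, x_m]]`. -/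
def zTerm (R : Type*) [CommRing R] (m : ℕ) (μ : YoungDiagram) : Series R m :=
  MvPowerSeries.C (omega (MvPolynomial.X 0) (MvPolynomial.X 1) (MvPolynomial.X 2)
      (MvPolynomial.X 3 : Coeffs R) μ) *
    (schur (Coeffs R) m μ : MvPowerSeries (Fin m) (Coeffs R))

/-- `z` is the formal sum of the family `f` of power series: every monomial occurs in only finitely
many members of the family, and its coefficient in `z` is the sum of its coefficients in them. -/
def IsFormalSum {ι σ S : Type*} [CommRing S] (f : ι → MvPowerSeries σ S)
    (z : MvPowerSeries σ S) : Prop :=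
  ∀ e : σ →₀ ℕ, {i | MvPowerSeries.coeff e (f i) ≠ 0}.Finite ∧
    MvPowerSeries.coeff e z = ∑ᶠ i, MvPowerSeries.coeff e (f i)

end StanleySchur

end

/-!
Put `ℓ_j = λ_j + 2n - j`. In terms of these strictly decreasing exponents Stanley's weight is a
product over pairs of neighbours: `(abcd)^(n choose 2) ω(λ) = ∏_k A(ℓ_{2k-1}, ℓ_{2k})`, where
`A(k, l) = a^⌈(k-1)/2⌉ b^⌊(k-1)/2⌋ c^⌈l/2⌉ d^⌊l/2⌋` for `k > l` (`pow_mul_omega`). Extend `A`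
antisymmetrically to all pairs of exponents (`pairWeight`).

The generating function `Q(x, y) = ∑ A(k, l) x^k y^l` is rational, and `Q(x_i, x_j) = p_ij`: passing
from `(k, l)` to `(k + 2, l + 2)` multiplies `A` by `abcd`, and increasing the larger exponent by
`2` multiplies it by `ab`, so multiplication by the three factors of the denominator leaves a
polynomial (`mul_pairSeries_pairWeight`). It remains to prove
`(abcd)^(n choose 2) a_δ z_n = Pf (Q(x_i, x_j))`, which is done by comparing the coefficients of a
monomial `x^e` (`pow_mul_diffProd_mul_zSeries`).

* On the right, each variable occurs in a single factor of a term of the Pfaffian, so the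
  coefficient is `Pf (A(e_i, e_j))` (`coeff_pfaffian_pairSeries`).
* On the left, `a_δ s_λ` is an alternant. The monomial `x^e` occurs only if the exponents `e_i` are
  distinct; then it occurs for the one partition `λ` whose `ℓ` is the decreasing rearrangement of
  `e`, with the sign of the rearrangement as its coefficient.

Both sides are alternating in `e`, so what remains is that
`Pf (A(ℓ_i, ℓ_j)) = ∏_k A(ℓ_{2k-1}, ℓ_{2k})` for decreasing `ℓ`. As `A(k, l) = g(k) h(l)` for
`k > l`, this is the evaluation of a Pfaffian with entries
`g_p h_q` for `p < q` (`pfaffian_stairMatrix`). If `1` and `2` are not partners in a matching, both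
are the smaller elements of their blocks, and exchanging them changes the sign of the term and
nothing else. Thus only the matchings containing `{1, 2}` survive, and by the same argument `{3, 4}`
must be a block, and so on.

For these manipulations it is convenient that, up to the order of the hyperoctahedral group, the
Pfaffian is a sum over the whole symmetric group (`sum_pfTerm`), because the matching permutations
are a transversal of this subgroup (`isComplement_matchingPerm`). The order of the subgroup can be
cancelled over `ℤ[a, b, c, d]`, and the resulting identities specialise to every commutative ring.
-/

noncomputable section

namespace StanleySchur

open Equiv Equiv.Perm

/-! ### The hyperoctahedral group and perfect matchings -/

/-- The identification of `Fin n × Bool` with `Fin (2 * n)` under which the `i`-th block consists of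
`fstPos i = (i, false)` and `sndPos i = (i, true)`. -/
def blockEquiv (n : ℕ) : Fin n × Bool ≃ Fin (2 * n) where
  toFun p := if p.2 then sndPos p.1 else fstPos p.1
  invFun q := (⟨q / 2, by omega⟩, decide ((q : ℕ) % 2 = 1))
  left_inv := by
    rintro ⟨i, b⟩
    cases b <;> simp [fstPos, sndPos, Nat.mul_add_div, Nat.add_mod]
  right_inv q := by
    rcases Nat.mod_two_eq_zero_or_one q with h | h <;>
      simp [fstPos, sndPos, Fin.ext_iff, h] <;> omega

variable {n : ℕ}

@[simp] theorem blockEquiv_false (i : Fin n) : blockEquiv n (i, false) = fstPos i := rfl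

@[simp] theorem blockEquiv_true (i : Fin n) : blockEquiv n (i, true) = sndPos i := rfl

@[simp] theorem blockEquiv_symm_fstPos (i : Fin n) : (blockEquiv n).symm (fstPos i) = (i, false) :=
  (blockEquiv n).symm_apply_apply (i, false)

@[simp] theorem blockEquiv_symm_sndPos (i : Fin n) : (blockEquiv n).symm (sndPos i) = (i, true) :=
  (blockEquiv n).symm_apply_apply (i, true)

theorem fstPos_injective : Function.Injective (fstPos : Fin n → Fin (2 * n)) := fun i j h => by
  simpa using congrArg (blockEquiv n).symm h

theorem sndPos_injective : Function.Injective (sndPos : Fin n → Fin (2 * n)) := fun i j h => by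
  simpa using congrArg (blockEquiv n).symm h

theorem fstPos_ne_sndPos (i j : Fin n) : fstPos i ≠ sndPos j := fun h => by
  simpa using congrArg (blockEquiv n).symm h

theorem eq_fstPos_or_eq_sndPos (p : Fin (2 * n)) : ∃ i : Fin n, p = fstPos i ∨ p = sndPos i := by
  obtain ⟨⟨i, b⟩, rfl⟩ := (blockEquiv n).surjective p
  cases b <;> simp [fstPos_injective.eq_iff, sndPos_injective.eq_iff, fstPos_ne_sndPos]

theorem prod_fstPos_mul_sndPos {S : Type*} [CommMonoid S] (f : Fin (2 * n) → S) :
    ∏ p, f p = ∏ i : Fin n, f (fstPos i) * f (sndPos i) := by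
  rw [← (blockEquiv n).prod_comp, Fintype.prod_prod_type]
  simp [mul_comm]

/-- The involution exchanging the two elements of every block. -/
def blockFlip (n : ℕ) : Perm (Fin (2 * n)) :=
  (blockEquiv n).permCongr (Equiv.prodCongr (Equiv.refl _) Equiv.boolNot)

@[simp] theorem blockFlip_fstPos (i : Fin n) : blockFlip n (fstPos i) = sndPos i := by
  simp [blockFlip, Equiv.permCongr_apply]

@[simp] theorem blockFlip_sndPos (i : Fin n) : blockFlip n (sndPos i) = fstPos i := by
  simp [blockFlip, Equiv.permCongr_apply]

/-- The permutation of positions that permutes the blocks by `π` and keeps the order within each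
block. -/
def blockPerm (π : Perm (Fin n)) : Perm (Fin (2 * n)) :=
  (blockEquiv n).permCongr (Equiv.prodCongr π (Equiv.refl _))

@[simp] theorem blockPerm_fstPos (π : Perm (Fin n)) (i : Fin n) :
    blockPerm π (fstPos i) = fstPos (π i) := by
  simp [blockPerm, Equiv.permCongr_apply]

@[simp] theorem blockPerm_sndPos (π : Perm (Fin n)) (i : Fin n) :
    blockPerm π (sndPos i) = sndPos (π i) := by
  simp [blockPerm, Equiv.permCongr_apply]

theorem sign_blockPerm (π : Perm (Fin n)) : sign (blockPerm π) = 1 := by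
  have h : Equiv.prodCongr π (Equiv.refl Bool) = prodCongrLeft (fun _ : Bool => π) := by
    ext <;> simp
  rw [blockPerm, sign_permCongr, h, sign_prodCongrLeft]
  simp

/-- The hyperoctahedral group: the permutations of `Fin (2 * n)` preserving the standard matching,
generated by the exchanges within one block and the permutations of the blocks. -/
def hyperoctahedral (n : ℕ) : Subgroup (Perm (Fin (2 * n))) :=
  Subgroup.closure
    (Set.range (fun i : Fin n => swap (fstPos i) (sndPos i)) ∪ Set.range blockPerm)

theorem blockFlip_comm_of_mem {h : Perm (Fin (2 * n))} (hh : h ∈ hyperoctahedral n) :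
    h * blockFlip n = blockFlip n * h := by
  have hle : hyperoctahedral n ≤ Subgroup.centralizer {blockFlip n} := by
    rw [hyperoctahedral, Subgroup.closure_le]
    rintro g (⟨i, rfl⟩ | ⟨π, rfl⟩) <;>
      rw [SetLike.mem_coe, Subgroup.mem_centralizer_singleton_iff] <;> ext p : 1 <;>
      obtain ⟨j, rfl | rfl⟩ := eq_fstPos_or_eq_sndPos p
    · by_cases hij : j = i
      · subst hij; simp
      · simp [swap_apply_of_ne_of_ne, fstPos_injective.ne hij, sndPos_injective.ne hij,
          fstPos_ne_sndPos, (fstPos_ne_sndPos _ _).symm]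
    · by_cases hij : j = i
      · subst hij; simp
      · simp [swap_apply_of_ne_of_ne, fstPos_injective.ne hij, sndPos_injective.ne hij,
          fstPos_ne_sndPos, (fstPos_ne_sndPos _ _).symm]
    · simp
    · simp
  have := hle hh
  rwa [Subgroup.mem_centralizer_singleton_iff] at this

theorem fin_eq_of_strictMono {m : ℕ} {f : Fin m → Fin m} (hf : StrictMono f) (i : Fin m) :
    f i = i := by
  have := DFunLike.congr_fun (Subsingleton.elim
    (hf.orderIsoOfSurjective f (Finite.surjective_of_injective hf.injective))
    (OrderIso.refl (Fin m))) i
  simpa using this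

/-- Two listings of the same matching, both in normal form, agree. -/
theorem IsMatchingPerm.eq_one_of_mul {σ h : Perm (Fin (2 * n))} (hσ : IsMatchingPerm σ)
    (hσh : IsMatchingPerm (σ * h)) (hh : h * blockFlip n = blockFlip n * h) : h = 1 := by
  have hsnd : ∀ i, h (sndPos i) = blockFlip n (h (fstPos i)) := fun i => by
    simpa using congrArg (fun g : Perm _ => g (fstPos i)) hh
  have hfst : ∀ i, ∃ j, h (fstPos i) = fstPos j := fun i => by
    obtain ⟨j, hj | hj⟩ := eq_fstPos_or_eq_sndPos (h (fstPos i))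
    · exact ⟨j, hj⟩
    · have h1 := hσh.1 i
      have h2 := hσ.1 j
      simp only [Perm.mul_apply, hsnd, hj, blockFlip_sndPos] at h1
      exact absurd h1 h2.asymm
  choose f hf using hfst
  have hmono : StrictMono f := fun i j hij => by
    have h1 := hσh.2 i j hij
    simp only [Perm.mul_apply, hf] at h1
    by_contra hcon
    rcases (not_lt.1 hcon).lt_or_eq with h2 | h2
    · exact (hσ.2 _ _ h2).asymm h1
    · rw [h2] at h1; exact h1.false
  have hid := fin_eq_of_strictMono hmono
  ext p : 1
  obtain ⟨i, rfl | rfl⟩ := eq_fstPos_or_eq_sndPos p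
  · simp [hf, hid]
  · simp [hsnd, hf, hid]

theorem swap_mem_hyperoctahedral (i : Fin n) : swap (fstPos i) (sndPos i) ∈ hyperoctahedral n :=
  Subgroup.subset_closure (Or.inl ⟨i, rfl⟩)

theorem blockPerm_mem_hyperoctahedral (π : Perm (Fin n)) : blockPerm π ∈ hyperoctahedral n :=
  Subgroup.subset_closure (Or.inr ⟨π, rfl⟩)

theorem exists_mul_isMatchingPerm (τ : Perm (Fin (2 * n))) :
    ∃ h ∈ hyperoctahedral n, IsMatchingPerm (τ * h) := by
  classical
  -- Among the listings of the matching, one minimising the sum of the first elements of the blocks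
  -- has its blocks ordered internally; sorting the blocks then gives the normal form.
  obtain ⟨h, hh, hmin⟩ := Set.exists_min_image (hyperoctahedral n : Set (Perm (Fin (2 * n))))
    (fun h => ∑ i : Fin n, ((τ * h) (fstPos i) : ℕ)) (Set.toFinite _) ⟨1, one_mem _⟩
  have hlt : ∀ i, (τ * h) (fstPos i) < (τ * h) (sndPos i) := fun i => by
    by_contra hcon
    have hne : (τ * h) (fstPos i) ≠ (τ * h) (sndPos i) :=
      (τ * h).injective.ne (fstPos_ne_sndPos i i)
    have h1 := hmin _ (mul_mem hh (swap_mem_hyperoctahedral i))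
    refine absurd h1 (not_le.2 (Finset.sum_lt_sum (fun j _ => ?_) ⟨i, Finset.mem_univ i, ?_⟩))
    · by_cases hij : j = i
      · subst hij
        simp only [Perm.mul_apply, swap_apply_left] at hcon ⊢
        exact not_lt.1 hcon
      · simp [swap_apply_of_ne_of_ne, fstPos_injective.ne hij, fstPos_ne_sndPos]
    · simp only [Perm.mul_apply, swap_apply_left] at hcon hne ⊢
      exact lt_of_le_of_ne (not_lt.1 hcon) (fun h => hne (Fin.ext h).symm)
  let f : Fin n → Fin (2 * n) := fun i => (τ * h) (fstPos i)
  have hf : Function.Injective f := (τ * h).injective.comp fstPos_injective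
  have hmono : StrictMono (f ∘ Tuple.sort f) :=
    (Tuple.monotone_sort f).strictMono_of_injective (hf.comp (Tuple.sort f).injective)
  refine ⟨h * blockPerm (Tuple.sort f), mul_mem hh (blockPerm_mem_hyperoctahedral _), ?_, ?_⟩
  · intro i
    simpa using hlt (Tuple.sort f i)
  · intro i j hij
    simpa [f] using hmono hij

/-- The matching permutations form a transversal of the cosets of the hyperoctahedral group. -/
theorem isComplement_matchingPerm :
    Subgroup.IsComplement {σ : Perm (Fin (2 * n)) | IsMatchingPerm σ}
      (hyperoctahedral n : Set (Perm (Fin (2 * n)))) := by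
  rw [Subgroup.isComplement_iff_existsUnique]
  intro τ
  obtain ⟨h, hh, hm⟩ := exists_mul_isMatchingPerm τ
  refine ⟨(⟨τ * h, hm⟩, ⟨h⁻¹, inv_mem hh⟩), by simp, ?_⟩
  rintro ⟨⟨σ, hσ⟩, ⟨g, hg⟩⟩ hτ
  obtain rfl : σ * g = τ := hτ
  have hgh : g * h = 1 := hσ.eq_one_of_mul (by simpa [mul_assoc] using hm)
    (blockFlip_comm_of_mem (mul_mem hg hh))
  have hg' : g = h⁻¹ := eq_inv_of_mul_eq_one_left hgh
  subst hg'
  simp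

/-! ### Pfaffians as sums over the symmetric group -/

section Pfaffian

variable {S : Type*} [CommRing S]

/-- The term of `σ` in the Pfaffian, for an arbitrary permutation `σ`. -/
def pfTerm (A : Matrix (Fin (2 * n)) (Fin (2 * n)) S) (σ : Perm (Fin (2 * n))) : S :=
  ((sign σ : ℤ) : S) * ∏ i : Fin n, A (σ (fstPos i)) (σ (sndPos i))

theorem pfTerm_mul_of_mem {A : Matrix (Fin (2 * n)) (Fin (2 * n)) S}
    (hA : ∀ p q, A q p = -A p q) {h : Perm (Fin (2 * n))} (hh : h ∈ hyperoctahedral n)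
    (σ : Perm (Fin (2 * n))) : pfTerm A (σ * h) = pfTerm A σ := by
  induction hh using Subgroup.closure_induction generalizing σ with
  | mem g hg =>
    rcases hg with ⟨i, rfl⟩ | ⟨π, rfl⟩
    · have h1 : ∀ j, j ≠ i → A ((σ * swap (fstPos i) (sndPos i)) (fstPos j))
          ((σ * swap (fstPos i) (sndPos i)) (sndPos j)) = A (σ (fstPos j)) (σ (sndPos j)) :=
        fun j hj => by
          simp [swap_apply_of_ne_of_ne, fstPos_injective.ne hj, sndPos_injective.ne hj,
            fstPos_ne_sndPos, (fstPos_ne_sndPos _ _).symm]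
      rw [pfTerm, pfTerm, ← Finset.mul_prod_erase _ _ (Finset.mem_univ i),
        ← Finset.mul_prod_erase _ (fun j => A (σ (fstPos j)) (σ (sndPos j))) (Finset.mem_univ i),
        Finset.prod_congr rfl (fun j hj => h1 j (Finset.ne_of_mem_erase hj))]
      simp only [Perm.mul_apply, swap_apply_left, swap_apply_right, Perm.sign_mul,
        sign_swap (fstPos_ne_sndPos i i), hA (σ (fstPos i))]
      push_cast
      ring
    · simp only [pfTerm, Perm.sign_mul, sign_blockPerm, mul_one, Perm.mul_apply, blockPerm_fstPos,
        blockPerm_sndPos]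
      rw [Equiv.prod_comp π (fun i => A (σ (fstPos i)) (σ (sndPos i)))]
  | one => simp
  | mul x y _ _ hx hy => rw [← mul_assoc, hy, hx]
  | inv x _ hx => rw [← hx (σ * x⁻¹)]; simp

/-- The sum of the Pfaffian terms over the whole symmetric group, which is the Pfaffian up to the
order of the hyperoctahedral group. -/
theorem sum_pfTerm {A : Matrix (Fin (2 * n)) (Fin (2 * n)) S} (hA : ∀ p q, A q p = -A p q) :
    ∑ σ, pfTerm A σ = (Nat.card (hyperoctahedral n) : S) * pfaffian A := by
  classical
  have hc := isComplement_matchingPerm (n := n)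
  rw [← hc.equiv.symm.sum_comp, Fintype.sum_prod_type]
  have h1 : ∀ (x : {σ : Perm (Fin (2 * n)) | IsMatchingPerm σ})
      (y : (hyperoctahedral n : Set (Perm (Fin (2 * n))))),
      pfTerm A (hc.equiv.symm (x, y)) = pfTerm A x := fun x y => by
    rw [show hc.equiv.symm (x, y) = x.1 * y.1 from rfl, pfTerm_mul_of_mem hA y.2]
  simp only [h1, Finset.sum_const, Finset.card_univ]
  rw [← Finset.smul_sum, nsmul_eq_mul, Nat.card_eq_fintype_card, pfaffian]
  congr 1
  rw [Finset.sum_subtype (p := fun σ => IsMatchingPerm σ) _ (by simp)]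
  rfl

theorem pfTerm_submatrix (A : Matrix (Fin (2 * n)) (Fin (2 * n)) S) (π σ : Perm (Fin (2 * n))) :
    pfTerm (A.submatrix π π) σ = ((sign π : ℤ) : S) * pfTerm A (π * σ) := by
  have h : ((sign π : ℤ) : S) * ((sign π : ℤ) : S) = 1 := by
    rw [← Int.cast_mul, ← Units.val_mul, Int.units_mul_self]; simp
  simp only [pfTerm, Perm.sign_mul, Matrix.submatrix_apply, Perm.mul_apply]
  push_cast
  linear_combination (-((sign σ : ℤ) : S) *
    ∏ i : Fin n, A (π (σ (fstPos i))) (π (σ (sndPos i)))) * h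

theorem sum_pfTerm_submatrix (A : Matrix (Fin (2 * n)) (Fin (2 * n)) S) (π : Perm (Fin (2 * n))) :
    ∑ σ, pfTerm (A.submatrix π π) σ = ((sign π : ℤ) : S) * ∑ σ, pfTerm A σ := by
  simp only [pfTerm_submatrix, ← Finset.mul_sum]
  rw [← Equiv.sum_comp (Equiv.mulLeft π) (fun σ => pfTerm A σ)]
  rfl

theorem map_pfaffian {T : Type*} [CommRing T] (f : S →+* T)
    (A : Matrix (Fin (2 * n)) (Fin (2 * n)) S) : f (pfaffian A) = pfaffian (A.map f) := by
  simp [pfaffian]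

/-- The Pfaffian only depends on the entries above the diagonal. -/
theorem pfaffian_congr {A B : Matrix (Fin (2 * n)) (Fin (2 * n)) S}
    (h : ∀ p q, p < q → A p q = B p q) : pfaffian A = pfaffian B := by
  classical
  refine Finset.sum_congr rfl fun σ hσ => ?_
  rw [Finset.prod_congr rfl fun i _ => h _ _ ((Finset.mem_filter.1 hσ).2.1 i)]

variable [IsDomain S] [CharZero S]

theorem pfaffian_eq_of_sum_pfTerm_eq {A B : Matrix (Fin (2 * n)) (Fin (2 * n)) S}
    (hA : ∀ p q, A q p = -A p q) (hB : ∀ p q, B q p = -B p q) {c : S}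
    (h : ∑ σ, pfTerm A σ = c * ∑ σ, pfTerm B σ) : pfaffian A = c * pfaffian B := by
  rw [sum_pfTerm hA, sum_pfTerm hB, mul_left_comm] at h
  exact mul_left_cancel₀ (Nat.cast_ne_zero.2 Nat.card_pos.ne') h

theorem pfaffian_submatrix {A : Matrix (Fin (2 * n)) (Fin (2 * n)) S}
    (hA : ∀ p q, A q p = -A p q) (π : Perm (Fin (2 * n))) :
    pfaffian (A.submatrix π π) = ((sign π : ℤ) : S) * pfaffian A :=
  pfaffian_eq_of_sum_pfTerm_eq (fun _ _ => hA _ _) hA (sum_pfTerm_submatrix A π)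

end Pfaffian

/-! ### Pfaffians of matrices of rank-one type -/

section Stair

variable {n : ℕ} {S : Type*} [CommRing S]

/-- The antisymmetric matrix whose entries above the diagonal are `g p * h q`. -/
def stairMatrix (g h : Fin (2 * n) → S) : Matrix (Fin (2 * n)) (Fin (2 * n)) S :=
  Matrix.of fun p q => if p < q then g p * h q else if q < p then -(g q * h p) else 0

theorem stairMatrix_antisymm (g h : Fin (2 * n) → S) (p q : Fin (2 * n)) :
    stairMatrix g h q p = -stairMatrix g h p q := by
  rcases lt_trichotomy p q with hpq | rfl | hpq
  · simp [stairMatrix, hpq, hpq.asymm]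
  · simp [stairMatrix]
  · simp [stairMatrix, hpq, hpq.asymm]

/-- The matrix `stairMatrix g h`, with the entries outside of the diagonal `2 × 2` blocks replaced
by zero in the rows and columns of the first `i` blocks. -/
def stairTrunc (g h : Fin (2 * n) → S) (i : ℕ) : Matrix (Fin (2 * n)) (Fin (2 * n)) S :=
  Matrix.of fun p q => if (p : ℕ) / 2 = q / 2 ∨ (2 * i ≤ (p : ℕ) ∧ 2 * i ≤ (q : ℕ)) then
    stairMatrix g h p q else 0

theorem stairTrunc_antisymm (g h : Fin (2 * n) → S) (i : ℕ) (p q : Fin (2 * n)) :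
    stairTrunc g h i q p = -stairTrunc g h i p q := by
  simp only [stairTrunc, Matrix.of_apply, stairMatrix_antisymm g h p q, eq_comm (a := (q : ℕ) / 2),
    and_comm (a := 2 * i ≤ (q : ℕ))]
  split_ifs <;> simp

theorem stairTrunc_zero (g h : Fin (2 * n) → S) : stairTrunc g h 0 = stairMatrix g h := by
  ext p q; simp [stairTrunc]

theorem val_swap_block (i : Fin n) (p : Fin (2 * n)) :
    (swap (fstPos i) (sndPos i) p : ℕ) =
      if (p : ℕ) = 2 * i then 2 * (i : ℕ) + 1 else if (p : ℕ) = 2 * i + 1 then 2 * (i : ℕ)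
      else p := by
  simp only [swap_apply_def, fstPos, sndPos, Fin.ext_iff]
  split_ifs <;> rfl

/-- Exchanging the two positions of the `i`-th block multiplies an entry of the truncated matrix by
a factor of the form `c p * c q`, provided that the entry is outside of the `i`-th diagonal block:
since the entries to the left of this block vanish, the entry only depends on the positions of
the block through `g`. -/
theorem stairTrunc_swap (g h : Fin (2 * n) → S) (i : Fin n) {p q : Fin (2 * n)}
    (hpq : ¬((p : ℕ) / 2 = i ∧ (q : ℕ) / 2 = i)) :
    stairTrunc g h i (swap (fstPos i) (sndPos i) p) (swap (fstPos i) (sndPos i) q) * (g p * g q) =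
      stairTrunc g h i p q *
        (g (swap (fstPos i) (sndPos i) p) * g (swap (fstPos i) (sndPos i) q)) := by
  wlog hlt : p < q generalizing p q
  · rcases (not_lt.1 hlt).lt_or_eq with h1 | rfl
    · have := this (fun h => hpq h.symm) h1
      rw [stairTrunc_antisymm _ _ _ (swap (fstPos i) (sndPos i) p),
        stairTrunc_antisymm _ _ _ p] at this
      linear_combination -this
    · simp [stairTrunc, stairMatrix]
  have hp := val_swap_block i p
  have hq := val_swap_block i q
  have hq' : (q : ℕ) / 2 ≠ i → swap (fstPos i) (sndPos i) q = q := fun h1 => by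
    refine Fin.ext ?_
    rw [hq]; split_ifs <;> omega
  set p' := swap (fstPos i) (sndPos i) p
  set q' := swap (fstPos i) (sndPos i) q
  rw [Fin.lt_def] at hlt
  simp only [stairTrunc, stairMatrix, Matrix.of_apply, Fin.lt_def]
  by_cases hcond : (p : ℕ) / 2 = q / 2 ∨ (2 * (i : ℕ) ≤ p ∧ 2 * (i : ℕ) ≤ q)
  · have hlt' : (p' : ℕ) < q' := by rw [hp, hq]; split_ifs <;> omega
    have hcond' : (p' : ℕ) / 2 = q' / 2 ∨ (2 * (i : ℕ) ≤ p' ∧ 2 * (i : ℕ) ≤ q') := by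
      rw [hp, hq]; split_ifs <;> omega
    rw [if_pos hcond, if_pos hcond', if_pos hlt, if_pos hlt', hq' (by omega)]
    ring
  · have hcond' : ¬((p' : ℕ) / 2 = q' / 2 ∨ (2 * (i : ℕ) ≤ p' ∧ 2 * (i : ℕ) ≤ q')) := by
      rw [hp, hq]; split_ifs <;> omega
    rw [if_neg hcond, if_neg hcond', zero_mul, zero_mul]

variable [IsDomain S] [CharZero S]

/-- The terms of permutations not matching the two elements of the `i`-th block cancel in pairs, so
the entries in its rows and columns outside of the diagonal `2 × 2` block can be dropped. -/
theorem sum_pfTerm_stairTrunc_succ {g : Fin (2 * n) → S} (hg : ∀ p, g p ≠ 0)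
    (h : Fin (2 * n) → S) (i : Fin n) :
    ∑ τ, pfTerm (stairTrunc g h i) τ = ∑ τ, pfTerm (stairTrunc g h (i + 1)) τ := by
  set s := swap (fstPos i) (sndPos i) with hs
  have hval : ∀ p, (s p : ℕ) / 2 = i ↔ (p : ℕ) / 2 = i := fun p => by
    rw [hs, val_swap_block]; split_ifs <;> omega
  -- The differences `f τ` of the two terms are negated by the exchange `s`; they vanish if `τ`
  -- matches the two elements of the `i`-th block with each other, a property denoted `B τ`.
  let f : Perm (Fin (2 * n)) → S := fun τ =>
    pfTerm (stairTrunc g h i) τ - pfTerm (stairTrunc g h (i + 1)) τ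
  let B : Perm (Fin (2 * n)) → Prop := fun τ =>
    ∀ k, (τ (fstPos k) : ℕ) / 2 = i ↔ (τ (sndPos k) : ℕ) / 2 = i
  have hB : ∀ τ, B (s * τ) ↔ B τ := fun τ => by simp [B, hval]
  have hBf : ∀ τ, B τ → f τ = 0 := fun τ hτ => by
    simp only [f, pfTerm, sub_eq_zero]
    congr 1
    refine Finset.prod_congr rfl fun k _ => ?_
    have := hτ k
    simp only [stairTrunc, Matrix.of_apply]
    refine if_congr ?_ rfl rfl
    omega
  have hBs : ∀ τ, ¬B τ → pfTerm (stairTrunc g h (i + 1)) τ = 0 := fun τ hτ => by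
    obtain ⟨k, hk⟩ := not_forall.1 hτ
    rw [pfTerm, Finset.prod_eq_zero (Finset.mem_univ k), mul_zero]
    simp only [stairTrunc, Matrix.of_apply]
    refine if_neg ?_
    omega
  have hneg : ∀ τ, f (s * τ) = -f τ := fun τ => by
    by_cases hτ : B τ
    · rw [hBf τ hτ, hBf _ ((hB τ).2 hτ), neg_zero]
    · simp only [f, hBs τ hτ, hBs _ (fun h => hτ ((hB τ).1 h)), sub_zero]
      -- Otherwise the two elements of the `i`-th block have different partners.
      have hsep : ∀ k, ¬((τ (fstPos k) : ℕ) / 2 = i ∧ (τ (sndPos k) : ℕ) / 2 = i) := by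
        rintro k ⟨h1, h2⟩
        refine hτ fun l => ?_
        by_cases hkl : l = k
        · subst hkl; simp [h1, h2]
        · have e1 := Fin.val_ne_of_ne (τ.injective.ne (fstPos_ne_sndPos k k))
          have e2 := Fin.val_ne_of_ne (τ.injective.ne (fstPos_ne_sndPos l k))
          have e3 := Fin.val_ne_of_ne (τ.injective.ne (fstPos_ne_sndPos k l))
          have e4 := Fin.val_ne_of_ne (τ.injective.ne (fstPos_injective.ne hkl))
          have e5 := Fin.val_ne_of_ne (τ.injective.ne (sndPos_injective.ne hkl))
          omega
      have hprod := Finset.prod_congr (rfl : (Finset.univ : Finset (Fin n)) = Finset.univ)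
        (fun k _ => stairTrunc_swap g h i (hsep k))
      have hg1 : (∏ k, g (τ (fstPos k))) * ∏ k, g (τ (sndPos k)) = ∏ p, g p := by
        rw [← Finset.prod_mul_distrib, ← prod_fstPos_mul_sndPos (fun p => g (τ p)),
          Equiv.prod_comp τ g]
      have hg2 : (∏ k, g (s (τ (fstPos k)))) * ∏ k, g (s (τ (sndPos k))) = ∏ p, g p := by
        rw [← Finset.prod_mul_distrib, ← prod_fstPos_mul_sndPos (fun p => g (s (τ p))),
          Equiv.prod_comp τ (fun p => g (s p)), Equiv.prod_comp s g]
      simp only [Finset.prod_mul_distrib] at hprod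
      rw [hg1, hg2] at hprod
      have := mul_right_cancel₀ (Finset.prod_ne_zero_iff.2 fun p _ => hg p) hprod
      simp only [pfTerm, Perm.mul_apply, this, Perm.sign_mul, hs, sign_swap (fstPos_ne_sndPos i i)]
      push_cast
      ring
  have hsum : ∑ τ, f τ = -∑ τ, f τ := by
    rw [← Finset.sum_neg_distrib, ← Equiv.sum_comp (Equiv.mulLeft s) f]
    exact Finset.sum_congr rfl fun τ _ => hneg τ
  rw [← sub_eq_zero, ← Finset.sum_sub_distrib]
  exact self_eq_neg.1 hsum

/-- The Pfaffian of the antisymmetric matrix with entries `g p * h q` for `p < q`: only the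
standard matching contributes after cancellation. -/
theorem pfaffian_stairMatrix {g : Fin (2 * n) → S} (hg : ∀ p, g p ≠ 0) (h : Fin (2 * n) → S) :
    pfaffian (stairMatrix g h) = ∏ i : Fin n, g (fstPos i) * h (sndPos i) := by
  classical
  have hsum : ∀ i ≤ n, ∑ τ, pfTerm (stairMatrix g h) τ = ∑ τ, pfTerm (stairTrunc g h i) τ := by
    intro i
    induction i with
    | zero => intro _; rw [stairTrunc_zero]
    | succ i ih => exact fun hi => (ih (by omega)).trans (sum_pfTerm_stairTrunc_succ hg h ⟨i, hi⟩)
  rw [pfaffian_eq_of_sum_pfTerm_eq (c := 1) (stairMatrix_antisymm g h) (stairTrunc_antisymm g h n)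
    (by rw [one_mul, hsum n le_rfl]), one_mul, pfaffian]
  have hone : IsMatchingPerm (1 : Perm (Fin (2 * n))) :=
    ⟨fun i => by simp [fstPos, sndPos], fun i j hij => by simpa [fstPos] using hij⟩
  rw [Finset.sum_eq_single_of_mem 1 (by simpa using hone)]
  · rw [Perm.sign_one, Units.val_one, Int.cast_one, one_mul]
    refine Finset.prod_congr rfl fun i _ => ?_
    simp [stairTrunc, stairMatrix, fstPos, sndPos, Nat.mul_add_div]
  · intro σ hσ hne
    by_contra hcon
    refine hne ?_
    replace hσ := (Finset.mem_filter.1 hσ).2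
    have hblock : ∀ i, (σ (fstPos i) : ℕ) / 2 = (σ (sndPos i) : ℕ) / 2 := fun i => by
      by_contra h1
      refine hcon ?_
      rw [Finset.prod_eq_zero (Finset.mem_univ i), mul_zero]
      simp only [stairTrunc, Matrix.of_apply]
      refine if_neg ?_
      omega
    have hflip : ∀ i, σ (sndPos i) = blockFlip n (σ (fstPos i)) := fun i => by
      have h1 := hblock i
      have h2 := Fin.val_ne_of_ne (σ.injective.ne (fstPos_ne_sndPos i i))
      obtain ⟨j, hj | hj⟩ := eq_fstPos_or_eq_sndPos (σ (fstPos i)) <;>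
        rw [hj] at h1 h2 ⊢ <;> simp only [blockFlip_fstPos, blockFlip_sndPos] <;>
        refine Fin.ext ?_ <;> simp only [fstPos, sndPos] at h1 h2 ⊢ <;> omega
    refine hone.eq_one_of_mul (by simpa using hσ) (Equiv.ext fun p => ?_)
    obtain ⟨i, rfl | rfl⟩ := eq_fstPos_or_eq_sndPos p
    · simp [hflip]
    · have hinv : ∀ q, blockFlip n (blockFlip n q) = q := fun q => by
        obtain ⟨j, rfl | rfl⟩ := eq_fstPos_or_eq_sndPos q <;> simp
      simp [hflip, hinv]

end Stair

/-! ### The coefficients of the entries -/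

section Weight

variable {S T : Type*} [CommRing S] [CommRing T]

/-- The weight `a^⌈(k-1)/2⌉ b^⌊(k-1)/2⌋ c^⌈l/2⌉ d^⌊l/2⌋` of a pair of exponents `k > l`, extended
antisymmetrically to all pairs. -/
def pairWeight (a b c d : S) (k l : ℕ) : S :=
  if l < k then a ^ (k / 2) * b ^ ((k - 1) / 2) * (c ^ ((l + 1) / 2) * d ^ (l / 2))
  else if k < l then -(a ^ (l / 2) * b ^ ((l - 1) / 2) * (c ^ ((k + 1) / 2) * d ^ (k / 2)))
  else 0

theorem pairWeight_antisymm (a b c d : S) (k l : ℕ) :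
    pairWeight a b c d l k = -pairWeight a b c d k l := by
  rcases lt_trichotomy k l with h | rfl | h
  · simp [pairWeight, h, h.asymm]
  · simp [pairWeight]
  · simp [pairWeight, h, h.asymm]

theorem map_pairWeight (f : S →+* T) (a b c d : S) (k l : ℕ) :
    f (pairWeight a b c d k l) = pairWeight (f a) (f b) (f c) (f d) k l := by
  unfold pairWeight
  split_ifs <;> simp

theorem exists_ringHom_X (a b c d : S) : ∃ φ : MvPolynomial (Fin 4) ℤ →+* S,
    φ (MvPolynomial.X 0) = a ∧ φ (MvPolynomial.X 1) = b ∧ φ (MvPolynomial.X 2) = c ∧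
      φ (MvPolynomial.X 3) = d :=
  ⟨MvPolynomial.eval₂Hom (Int.castRingHom S) ![a, b, c, d], by simp, by simp, by simp, by simp⟩

variable {n : ℕ}

/-- The Pfaffian of the pair weights of distinct exponents, which `σ` arranges in decreasing
order. -/
theorem pfaffian_pairWeight (a b c d : S) (e : Fin (2 * n) → ℕ) (σ : Perm (Fin (2 * n)))
    (he : StrictAnti (e ∘ σ)) :
    pfaffian (Matrix.of fun i j => pairWeight a b c d (e i) (e j)) =
      ((sign σ : ℤ) : S) *
        ∏ i : Fin n, pairWeight a b c d (e (σ (fstPos i))) (e (σ (sndPos i))) := by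
  -- It suffices to treat indeterminates over the integers.
  suffices hZ : pfaffian (Matrix.of fun i j => pairWeight (MvPolynomial.X 0) (MvPolynomial.X 1)
      (MvPolynomial.X 2) (MvPolynomial.X 3 : MvPolynomial (Fin 4) ℤ) (e i) (e j)) =
      ((sign σ : ℤ) : MvPolynomial (Fin 4) ℤ) *
        ∏ i : Fin n, pairWeight (MvPolynomial.X 0) (MvPolynomial.X 1)
          (MvPolynomial.X 2) (MvPolynomial.X 3) (e (σ (fstPos i))) (e (σ (sndPos i))) by
    obtain ⟨φ, h0, h1, h2, h3⟩ := exists_ringHom_X a b c d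
    have := congrArg φ hZ
    simpa [map_pfaffian, map_pairWeight, Matrix.map, h0, h1, h2, h3] using this
  set A : Matrix (Fin (2 * n)) (Fin (2 * n)) (MvPolynomial (Fin 4) ℤ) :=
    Matrix.of fun i j => pairWeight (MvPolynomial.X 0) (MvPolynomial.X 1)
      (MvPolynomial.X 2) (MvPolynomial.X 3 : MvPolynomial (Fin 4) ℤ) (e i) (e j) with hA
  have hanti : ∀ p q, A q p = -A p q := fun p q => pairWeight_antisymm _ _ _ _ _ _
  have hsub : A.submatrix σ σ = stairMatrix
      (fun p => MvPolynomial.X 0 ^ (e (σ p) / 2) * MvPolynomial.X 1 ^ ((e (σ p) - 1) / 2))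
      (fun q => MvPolynomial.X 2 ^ ((e (σ q) + 1) / 2) * MvPolynomial.X 3 ^ (e (σ q) / 2)) := by
    ext1 p q
    rcases lt_trichotomy p q with h | rfl | h
    · have := he h
      simp only [Function.comp_apply] at this
      simp [hA, stairMatrix, pairWeight, h, this]
    · simp [hA, stairMatrix, pairWeight]
    · have := he h
      simp only [Function.comp_apply] at this
      simp [hA, stairMatrix, pairWeight, h, h.asymm, this, this.asymm]
  have h1 := pfaffian_submatrix hanti σ
  rw [hsub, pfaffian_stairMatrix (fun p => by simp [MvPolynomial.X_ne_zero])] at h1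
  have h2 : ((sign σ : ℤ) : MvPolynomial (Fin 4) ℤ) *
      ((sign σ : ℤ) : MvPolynomial (Fin 4) ℤ) = 1 := by
    rw [← Int.cast_mul, ← Units.val_mul, Int.units_mul_self]; simp
  have h3 : ∀ i : Fin n, pairWeight (MvPolynomial.X 0) (MvPolynomial.X 1)
      (MvPolynomial.X 2) (MvPolynomial.X 3 : MvPolynomial (Fin 4) ℤ)
      (e (σ (fstPos i))) (e (σ (sndPos i))) =
      MvPolynomial.X 0 ^ (e (σ (fstPos i)) / 2) * MvPolynomial.X 1 ^ ((e (σ (fstPos i)) - 1) / 2) *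
      (MvPolynomial.X 2 ^ ((e (σ (sndPos i)) + 1) / 2) *
        MvPolynomial.X 3 ^ (e (σ (sndPos i)) / 2)) := fun i => by
    have : e (σ (sndPos i)) < e (σ (fstPos i)) := he (by simp [fstPos, sndPos])
    rw [pairWeight, if_pos this]
  rw [Finset.prod_congr rfl fun i _ => h3 i, h1, ← mul_assoc, h2, one_mul]

theorem pfaffian_pairWeight_of_not_injective (a b c d : S) (e : Fin (2 * n) → ℕ)
    (he : ¬Function.Injective e) :
    pfaffian (Matrix.of fun i j => pairWeight a b c d (e i) (e j)) = 0 := by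
  suffices hZ : pfaffian (Matrix.of fun i j => pairWeight (MvPolynomial.X 0) (MvPolynomial.X 1)
      (MvPolynomial.X 2) (MvPolynomial.X 3 : MvPolynomial (Fin 4) ℤ) (e i) (e j)) = 0 by
    obtain ⟨φ, h0, h1, h2, h3⟩ := exists_ringHom_X a b c d
    have := congrArg φ hZ
    simpa [map_pfaffian, map_pairWeight, Matrix.map, h0, h1, h2, h3] using this
  set A : Matrix (Fin (2 * n)) (Fin (2 * n)) (MvPolynomial (Fin 4) ℤ) :=
    Matrix.of fun i j => pairWeight (MvPolynomial.X 0) (MvPolynomial.X 1)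
      (MvPolynomial.X 2) (MvPolynomial.X 3 : MvPolynomial (Fin 4) ℤ) (e i) (e j) with hA
  obtain ⟨i, j, hij, hne⟩ : ∃ i j, e i = e j ∧ i ≠ j := by
    simpa [Function.Injective] using he
  have he' : ∀ p, e (swap i j p) = e p := fun p => by
    rw [swap_apply_def]; split_ifs with h1 h2 <;> simp [*]
  have h1 := pfaffian_submatrix (A := A) (fun p q => pairWeight_antisymm _ _ _ _ _ _) (swap i j)
  have h2 : A.submatrix (swap i j) (swap i j) = A := by
    ext1 p q
    simp [hA, he']
  rw [h2, sign_swap hne] at h1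
  refine self_eq_neg.1 (h1.trans ?_)
  simp

end Weight

/-! ### Power series in two of the variables -/

section PairSeries

variable {m : ℕ} {S : Type*} [CommRing S]

/-- The power series `∑ f k l * x_i ^ k * x_j ^ l` (for `i ≠ j`). -/
def pairSeries (i j : Fin m) (f : ℕ → ℕ → S) : MvPowerSeries (Fin m) S :=
  fun e => open Classical in if ∀ p, p ≠ i → p ≠ j → e p = 0 then f (e i) (e j) else 0

open Classical in
theorem coeff_pairSeries (i j : Fin m) (f : ℕ → ℕ → S) (e : Fin m →₀ ℕ) :
    MvPowerSeries.coeff e (pairSeries i j f) =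
      if ∀ p, p ≠ i → p ≠ j → e p = 0 then f (e i) (e j) else 0 := rfl

theorem pairSeries_sub (i j : Fin m) (f g : ℕ → ℕ → S) :
    pairSeries i j (f - g) = pairSeries i j f - pairSeries i j g := by
  ext e
  simp only [map_sub, coeff_pairSeries]
  split_ifs <;> simp

theorem pairSeries_add (i j : Fin m) (f g : ℕ → ℕ → S) :
    pairSeries i j (f + g) = pairSeries i j f + pairSeries i j g := by
  ext e
  simp only [map_add, coeff_pairSeries]
  split_ifs <;> simp

/-- The coefficients of `s * x ^ u * y ^ v * ∑ f k l * x ^ k * y ^ l`. -/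
def shift (u v : ℕ) (s : S) (f : ℕ → ℕ → S) : ℕ → ℕ → S :=
  fun k l => if u ≤ k ∧ v ≤ l then s * f (k - u) (l - v) else 0

theorem pairSeries_shift {i j : Fin m} (hij : i ≠ j) (u v : ℕ) (s : S) (f : ℕ → ℕ → S) :
    pairSeries i j (shift u v s f) =
      MvPowerSeries.C s * (MvPowerSeries.X i ^ u * MvPowerSeries.X j ^ v) * pairSeries i j f := by
  have hmon : MvPowerSeries.C s * (MvPowerSeries.X i ^ u * MvPowerSeries.X j ^ v) =
      MvPowerSeries.monomial (Finsupp.single i u + Finsupp.single j v) s := by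
    rw [MvPowerSeries.X_pow_eq, MvPowerSeries.X_pow_eq, MvPowerSeries.monomial_mul_monomial,
      ← MvPowerSeries.monomial_zero_eq_C_apply, MvPowerSeries.monomial_mul_monomial]
    simp
  ext e
  rw [hmon, MvPowerSeries.coeff_monomial_mul]
  have hle : Finsupp.single i u + Finsupp.single j v ≤ e ↔ u ≤ e i ∧ v ≤ e j := by
    constructor
    · intro h
      have h1 := h i
      have h2 := h j
      simp [hij, hij.symm] at h1 h2
      exact ⟨h1, h2⟩
    · rintro ⟨h1, h2⟩ p
      by_cases hi : p = i
      · subst hi; simpa [hij, hij.symm] using h1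
      · by_cases hj : p = j
        · subst hj; simpa [hij, hij.symm] using h2
        · simp [hi, hj]
  have hpi : (e - (Finsupp.single i u + Finsupp.single j v)) i = e i - u := by simp [hij.symm]
  have hpj : (e - (Finsupp.single i u + Finsupp.single j v)) j = e j - v := by simp [hij]
  have hp : (∀ p, p ≠ i → p ≠ j → (e - (Finsupp.single i u + Finsupp.single j v)) p = 0) ↔
      ∀ p, p ≠ i → p ≠ j → e p = 0 :=
    forall_congr' fun p => imp_congr_right fun hi => imp_congr_right fun hj => by simp [hi, hj]
  rw [coeff_pairSeries, coeff_pairSeries, hpi, hpj]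
  simp only [hp, hle, shift]
  split_ifs <;> simp

/-- The coefficients of the constant series `1`. -/
def unitCoeff : ℕ → ℕ → S := fun k l => if k = 0 ∧ l = 0 then 1 else 0

theorem pairSeries_unitCoeff (i j : Fin m) :
    pairSeries i j (unitCoeff : ℕ → ℕ → S) = 1 := by
  classical
  ext e
  rw [coeff_pairSeries, MvPowerSeries.coeff_one, unitCoeff]
  have h : e = 0 ↔ (∀ p, p ≠ i → p ≠ j → e p = 0) ∧ (e i = 0 ∧ e j = 0) := by
    refine ⟨by rintro rfl; simp, fun ⟨h1, h2, h3⟩ => Finsupp.ext fun p => ?_⟩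
    by_cases hi : p = i
    · rw [hi]; exact h2
    · by_cases hj : p = j
      · rw [hj]; exact h3
      · exact h1 p hi hj
  simp only [h]
  split_ifs <;> tauto

variable {n : ℕ}

/-- As the variables of the factors are disjoint, a monomial arises from a single choice of
monomials in the factors. -/
theorem coeff_prod_pairSeries (f : ℕ → ℕ → S) (σ : Perm (Fin (2 * n))) (e : Fin (2 * n) →₀ ℕ) :
    MvPowerSeries.coeff e (∏ k : Fin n, pairSeries (σ (fstPos k)) (σ (sndPos k)) f) =
      ∏ k : Fin n, f (e (σ (fstPos k))) (e (σ (sndPos k))) := by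
  classical
  rw [MvPowerSeries.coeff_prod]
  let l₀ : Fin n →₀ (Fin (2 * n) →₀ ℕ) := Finsupp.equivFunOnFinite.symm fun k =>
    e.filter fun p => p = σ (fstPos k) ∨ p = σ (sndPos k)
  have hl₀ : ∀ k p, l₀ k p = if p = σ (fstPos k) ∨ p = σ (sndPos k) then e p else 0 :=
    fun k p => by simp [l₀, Finsupp.filter_apply]
  have hcase : ∀ p, ∃ k, p = σ (fstPos k) ∨ p = σ (sndPos k) := fun p => by
    obtain ⟨k, hk⟩ := eq_fstPos_or_eq_sndPos (σ.symm p)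
    exact ⟨k, hk.imp (fun h => by simp [← h]) (fun h => by simp [← h])⟩
  have hne : ∀ p k j, j ≠ k → (p = σ (fstPos k) ∨ p = σ (sndPos k)) →
      p ≠ σ (fstPos j) ∧ p ≠ σ (sndPos j) := by
    rintro p k j hjk (rfl | rfl) <;>
      simp [fstPos_injective.eq_iff, sndPos_injective.eq_iff, fstPos_ne_sndPos,
        (fstPos_ne_sndPos _ _).symm, hjk.symm]
  -- A family of exponents with the right supports and sum `e` is `l₀`.
  have huniq : ∀ l : Fin n →₀ (Fin (2 * n) →₀ ℕ),
      (∀ k p, p ≠ σ (fstPos k) → p ≠ σ (sndPos k) → l k p = 0) → ∀ k p,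
      (p = σ (fstPos k) ∨ p = σ (sndPos k)) → (∑ k, l k) p = l k p := by
    intro l hl k p hp
    rw [Finsupp.finsetSum_apply, Finset.sum_eq_single_of_mem k (Finset.mem_univ k)]
    intro j _ hjk
    exact hl j p (hne p k j hjk hp).1 (hne p k j hjk hp).2
  have hsupp₀ : ∀ k p, p ≠ σ (fstPos k) → p ≠ σ (sndPos k) → l₀ k p = 0 :=
    fun k p h1 h2 => by rw [hl₀, if_neg (by simp [h1, h2])]
  rw [Finset.sum_eq_single_of_mem l₀]
  · refine Finset.prod_congr rfl fun k _ => ?_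
    rw [coeff_pairSeries, if_pos (hsupp₀ k), hl₀, hl₀, if_pos (Or.inl rfl), if_pos (Or.inr rfl)]
  · rw [Finset.mem_finsuppAntidiag]
    refine ⟨Finsupp.ext fun p => ?_, Finset.subset_univ _⟩
    obtain ⟨k, hk⟩ := hcase p
    rw [huniq l₀ hsupp₀ k p hk, hl₀, if_pos hk]
  · intro l hl hne'
    rw [Finset.mem_finsuppAntidiag] at hl
    by_contra hcon
    have hsupp : ∀ k p, p ≠ σ (fstPos k) → p ≠ σ (sndPos k) → l k p = 0 := fun k => by
      have := fun h0 => hcon (Finset.prod_eq_zero (Finset.mem_univ k) h0)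
      rw [coeff_pairSeries] at this
      exact (ite_ne_right_iff.1 this).1
    refine hne' (Finsupp.ext fun k => Finsupp.ext fun p => ?_)
    by_cases hp : p = σ (fstPos k) ∨ p = σ (sndPos k)
    · rw [hl₀, if_pos hp, ← huniq l hsupp k p hp, hl.1]
    · rw [not_or] at hp
      rw [hsupp k p hp.1 hp.2, hsupp₀ k p hp.1 hp.2]

theorem coeff_pfaffian_pairSeries (f : ℕ → ℕ → S) (e : Fin (2 * n) →₀ ℕ) :
    MvPowerSeries.coeff e (pfaffian (Matrix.of fun i j : Fin (2 * n) => pairSeries i j f)) =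
      pfaffian (Matrix.of fun i j => f (e i) (e j)) := by
  simp only [pfaffian, map_sum, Matrix.of_apply]
  refine Finset.sum_congr rfl fun σ _ => ?_
  rw [← coeff_prod_pairSeries, ← MvPowerSeries.coeff_C_mul, map_intCast]

/-! ### The generating function of the pair weights -/

variable (a b c d : S)

theorem pairWeight_add_two_add_two (k l : ℕ) :
    pairWeight a b c d (k + 2) (l + 2) = a * b * c * d * pairWeight a b c d k l := by
  rcases lt_trichotomy k l with h | rfl | h
  · obtain ⟨r, rfl⟩ := Nat.exists_eq_add_of_lt h
    simp only [pairWeight, show ¬(k + r + 1 + 2 < k + 2) by omega,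
      show k + 2 < k + r + 1 + 2 by omega, h.asymm, h, if_true, if_false,
      show (k + r + 1 + 2) / 2 = (k + r + 1) / 2 + 1 by omega,
      show (k + r + 1 + 2 - 1) / 2 = (k + r + 1 - 1) / 2 + 1 by omega,
      show (k + 2 + 1) / 2 = (k + 1) / 2 + 1 by omega, show (k + 2) / 2 = k / 2 + 1 by omega]
    ring
  · simp [pairWeight]
  · obtain ⟨r, rfl⟩ := Nat.exists_eq_add_of_lt h
    simp only [pairWeight, show l + 2 < l + r + 1 + 2 by omega,
      h, if_true, show (l + r + 1 + 2) / 2 = (l + r + 1) / 2 + 1 by omega,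
      show (l + r + 1 + 2 - 1) / 2 = (l + r + 1 - 1) / 2 + 1 by omega,
      show (l + 2 + 1) / 2 = (l + 1) / 2 + 1 by omega, show (l + 2) / 2 = l / 2 + 1 by omega]
    ring

theorem pairWeight_add_two_left {k l : ℕ} (h : l < k) :
    pairWeight a b c d (k + 2) l = a * b * pairWeight a b c d k l := by
  simp only [pairWeight, h, show l < k + 2 by omega, if_true, show (k + 2) / 2 = k / 2 + 1 by omega,
    show (k + 2 - 1) / 2 = (k - 1) / 2 + 1 by omega]
  ring

theorem pairWeight_add_two_right {k l : ℕ} (h : k < l) :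
    pairWeight a b c d k (l + 2) = a * b * pairWeight a b c d k l := by
  rw [pairWeight_antisymm, pairWeight_add_two_left a b c d h, pairWeight_antisymm a b c d l k]
  ring

/-- The coefficients of `(1 - abcd x² y²) ∑ pairWeight k l x ^ k y ^ l`: only those with `k ≤ 1` or
`l ≤ 1` survive. -/
theorem pairWeight_sub_shift :
    pairWeight a b c d - shift 2 2 (a * b * c * d) (pairWeight a b c d) =
      fun k l => if 2 ≤ k ∧ 2 ≤ l then 0 else pairWeight a b c d k l := by
  funext k l
  simp only [Pi.sub_apply, shift]
  split_ifs with h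
  · obtain ⟨⟨k, rfl⟩, ⟨l, rfl⟩⟩ := And.intro (Nat.exists_eq_add_of_le' h.1)
      (Nat.exists_eq_add_of_le' h.2)
    rw [pairWeight_add_two_add_two]
    simp
  · simp

/-- The coefficients of the numerator of `pEntry`, a determinant in which the terms with
`x² y²` cancel. -/
def numCoeff : ℕ → ℕ → S :=
  shift 1 0 1 unitCoeff + shift 2 0 a unitCoeff
    - shift 1 2 (a * (b + c)) unitCoeff
    - shift 1 3 (a * b * c) unitCoeff - shift 2 3 (a * (a * b * c)) unitCoeff
    - shift 0 1 1 unitCoeff - shift 0 2 a unitCoeff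
    + shift 2 1 (a * (b + c)) unitCoeff
    + shift 3 1 (a * b * c) unitCoeff + shift 3 2 (a * (a * b * c)) unitCoeff

/-- Multiplication by the factors `1 - abcd x² y²`, `1 - ab x²` and `1 - ab y²` turns the generating
function of the pair weights into a polynomial. -/
theorem shift_pairWeight_eq_numCoeff (F G : ℕ → ℕ → S)
    (hF : F = pairWeight a b c d - shift 2 2 (a * b * c * d) (pairWeight a b c d))
    (hG : G = F - shift 2 0 (a * b) F) :
    G - shift 0 2 (a * b) G = numCoeff a b c := by
  rw [pairWeight_sub_shift] at hF
  subst hF hG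
  funext k l
  rcases k with _ | _ | _ | _ | k <;> rcases l with _ | _ | _ | _ | l <;>
    simp [shift, numCoeff, unitCoeff, pairWeight_add_two_left, pairWeight_add_two_right] <;>
    simp [pairWeight] <;> ring

theorem mul_pairSeries_pairWeight {i j : Fin m} (hij : i ≠ j) :
    (1 - MvPowerSeries.C a * MvPowerSeries.C b * MvPowerSeries.X i ^ 2) *
      (1 - MvPowerSeries.C a * MvPowerSeries.C b * MvPowerSeries.X j ^ 2) *
      (1 - MvPowerSeries.C a * MvPowerSeries.C b * MvPowerSeries.C c * MvPowerSeries.C d *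
        MvPowerSeries.X i ^ 2 * MvPowerSeries.X j ^ 2) * pairSeries i j (pairWeight a b c d) =
    Matrix.det !![MvPowerSeries.X i + MvPowerSeries.C a * MvPowerSeries.X i ^ 2,
        1 - MvPowerSeries.C a * (MvPowerSeries.C b + MvPowerSeries.C c) * MvPowerSeries.X i ^ 2
          - MvPowerSeries.C a * MvPowerSeries.C b * MvPowerSeries.C c * MvPowerSeries.X i ^ 3;
      MvPowerSeries.X j + MvPowerSeries.C a * MvPowerSeries.X j ^ 2,
        1 - MvPowerSeries.C a * (MvPowerSeries.C b + MvPowerSeries.C c) * MvPowerSeries.X j ^ 2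
          - MvPowerSeries.C a * MvPowerSeries.C b * MvPowerSeries.C c *
            MvPowerSeries.X j ^ 3] := by
  have h := congrArg (pairSeries i j) (shift_pairWeight_eq_numCoeff a b c d _ _ rfl rfl)
  simp only [numCoeff, pairSeries_sub, pairSeries_add, pairSeries_shift hij, pairSeries_unitCoeff,
    map_mul, map_add, map_one] at h
  rw [Matrix.det_fin_two_of]
  linear_combination h

end PairSeries

/-! ### Partitions and alternants -/

section Alternant

variable {m : ℕ}

/-- The entries `μ_j + m - j` of `μ + δ` (with `j` counted from `0`). -/
def shiftedPart (m : ℕ) (μ : YoungDiagram) (j : Fin m) : ℕ := μ.rowLen j + (m - 1 - (j : ℕ))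

theorem strictAnti_shiftedPart (m : ℕ) (μ : YoungDiagram) : StrictAnti (shiftedPart m μ) := by
  intro i j hij
  have h1 := μ.rowLen_anti i j hij.le
  have h2 : (i : ℕ) < j := hij
  simp only [shiftedPart]
  omega

theorem rowLen_eq_zero {μ : YoungDiagram} {j : ℕ} (h : μ.colLen 0 ≤ j) : μ.rowLen j = 0 := by
  by_contra hne
  have : (j, 0) ∈ μ := YoungDiagram.mem_iff_lt_rowLen.2 (Nat.pos_of_ne_zero hne)
  exact absurd (YoungDiagram.mem_iff_lt_colLen.1 this) (not_lt.2 h)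

theorem shiftedPart_injective {μ ν : YoungDiagram} (hμ : μ.colLen 0 ≤ m) (hν : ν.colLen 0 ≤ m)
    (h : shiftedPart m μ = shiftedPart m ν) : μ = ν := by
  have hrow : ∀ i, μ.rowLen i = ν.rowLen i := fun i => by
    by_cases hi : i < m
    · have := congrFun h ⟨i, hi⟩
      simp only [shiftedPart] at this
      omega
    · rw [rowLen_eq_zero (by omega), rowLen_eq_zero (by omega)]
  refine YoungDiagram.ext (Finset.ext fun ⟨i, j⟩ => ?_)
  rw [YoungDiagram.mem_cells, YoungDiagram.mem_cells, YoungDiagram.mem_iff_lt_rowLen,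
    YoungDiagram.mem_iff_lt_rowLen, hrow]

theorem exists_shiftedPart_eq {l : Fin m → ℕ} (hl : StrictAnti l) :
    ∃ μ : YoungDiagram, μ.colLen 0 ≤ m ∧ shiftedPart m μ = l := by
  -- The entries of a strictly decreasing sequence of length `m` dominate `m - 1, …, 1, 0`, so the
  -- truncated subtraction in `part` below is exact.
  have hbound : ∀ k : ℕ, ∀ j : Fin m, (j : ℕ) + k + 1 = m → k ≤ l j := by
    intro k
    induction k with
    | zero => simp
    | succ k ih =>
      intro j hj
      have h1 := ih ⟨j + 1, by omega⟩ (by simp; omega)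
      have h2 : l ⟨j + 1, by omega⟩ < l j := hl (Fin.lt_def.2 (by simp))
      omega
  have hstep : ∀ i j : Fin m, i ≤ j → l j + (j - i : ℕ) ≤ l i := by
    intro i j hij
    obtain ⟨k, hk⟩ := Nat.exists_eq_add_of_le (Fin.le_def.1 hij)
    induction k generalizing j with
    | zero => obtain rfl : j = i := Fin.ext (by omega); simp
    | succ k ih =>
      have h1 := ih ⟨i + k, by omega⟩ (Fin.le_def.2 (by simp)) rfl
      have h2 : l j < l ⟨i + k, by omega⟩ := hl (Fin.lt_def.2 (by simp; omega))
      simp only at h1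
      omega
  let part : ℕ → ℕ := fun i => if h : i < m then l ⟨i, h⟩ - (m - 1 - i) else 0
  have hanti : ∀ i j, i ≤ j → part j ≤ part i := by
    intro i j hij
    by_cases hj : j < m
    · have := hstep ⟨i, by omega⟩ ⟨j, hj⟩ hij
      simp only [part, hj, show i < m by omega, dif_pos] at this ⊢
      omega
    · simp [part, hj]
  let μ : YoungDiagram :=
    { cells := (Finset.range m).biUnion fun i => (Finset.range (part i)).image fun j => (i, j)
      isLowerSet := by
        rintro ⟨i, j⟩ ⟨i', j'⟩ ⟨hi, hj⟩ h
        simp only [Finset.coe_biUnion, Set.mem_iUnion, Finset.mem_coe, Finset.mem_image,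
          Finset.mem_range, Prod.mk.injEq, exists_prop] at h ⊢ hi hj
        obtain ⟨i₀, h1, j₀, h2, rfl, rfl⟩ := h
        have := hanti _ _ hi
        exact ⟨i', by omega, j', by omega, rfl, rfl⟩ }
  have hmem : ∀ i j, (i, j) ∈ μ ↔ i < m ∧ j < part i := fun i j => by
    rw [← YoungDiagram.mem_cells]
    simp [μ]
  refine ⟨μ, ?_, funext fun j => ?_⟩
  · by_contra hcon
    have := YoungDiagram.mem_iff_lt_colLen.2 (not_le.1 hcon)
    exact absurd ((hmem _ _).1 this).1 (lt_irrefl m)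
  · have hrow : μ.rowLen j = part j := by
      refine eq_of_forall_lt_iff fun k => ?_
      rw [← YoungDiagram.mem_iff_lt_rowLen, hmem]
      simp
    have h1 := hbound (m - 1 - j) j (by omega)
    simp only [shiftedPart, hrow, part, j.2, dif_pos, Fin.eta]
    omega

theorem card_eq_sum_rowLen {μ : YoungDiagram} (h : μ.colLen 0 ≤ m) :
    μ.card = ∑ j : Fin m, μ.rowLen j := by
  rw [Fin.sum_univ_eq_sum_range μ.rowLen m, YoungDiagram.card,
    Finset.card_eq_sum_card_fiberwise (f := Prod.fst) (t := Finset.range m)]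
  · exact Finset.sum_congr rfl fun i _ => (μ.rowLen_eq_card).symm
  · rintro ⟨i, j⟩ hij
    have h1 : (i, 0) ∈ μ := μ.up_left_mem le_rfl (Nat.zero_le j) hij
    have h2 := YoungDiagram.mem_iff_lt_colLen.1 h1
    simp only [Finset.coe_range, Set.mem_Iio]
    omega

theorem finite_card_le (N : ℕ) : {μ : YoungDiagram | μ.card ≤ N}.Finite := by
  refine Set.Finite.of_finite_image (f := YoungDiagram.cells)
    ((Finset.range N ×ˢ Finset.range N).powerset.finite_toSet.subset ?_)
    (fun μ _ ν _ h => YoungDiagram.ext h)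
  rintro _ ⟨μ, hμ, rfl⟩
  rw [Finset.mem_coe, Finset.mem_powerset]
  rintro ⟨i, j⟩ hij
  have hcol : μ.colLen j ≤ μ.card := by
    rw [YoungDiagram.colLen_eq_card]; exact Finset.card_filter_le _ _
  have hrow : μ.rowLen i ≤ μ.card := by
    rw [YoungDiagram.rowLen_eq_card]; exact Finset.card_filter_le _ _
  have h1 := YoungDiagram.mem_iff_lt_colLen.1 ((YoungDiagram.mem_cells _).1 hij)
  have h2 := YoungDiagram.mem_iff_lt_rowLen.1 ((YoungDiagram.mem_cells _).1 hij)
  have h3 : μ.card ≤ N := hμ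
  simp only [Finset.mem_product, Finset.mem_range]
  omega

open Classical in
theorem coeff_alternant (S : Type*) [CommRing S] (μ : YoungDiagram) (e : Fin m →₀ ℕ) :
    MvPolynomial.coeff e (alternant S m μ) =
      ∑ σ : Perm (Fin m), ((sign σ : ℤ) : S) * if e ∘ σ = shiftedPart m μ then 1 else 0 := by
  rw [alternant, Matrix.det_apply', MvPolynomial.coeff_sum]
  refine Finset.sum_congr rfl fun σ _ => ?_
  have hmon : ∏ i, (MvPolynomial.X (σ i) : MvPolynomial (Fin m) S) ^
      (μ.rowLen i + (m - 1 - (i : ℕ))) = MvPolynomial.monomial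
        (Finsupp.equivFunOnFinite.symm (shiftedPart m μ ∘ σ.symm)) 1 := by
    rw [MvPolynomial.monomial_eq, Finsupp.prod_fintype _ _ (by simp), map_one, one_mul]
    refine Fintype.prod_equiv σ _ _ fun i => ?_
    simp [shiftedPart]
  have hiff : Finsupp.equivFunOnFinite.symm (shiftedPart m μ ∘ σ.symm) = e ↔
      e ∘ σ = shiftedPart m μ := by
    rw [Equiv.symm_apply_eq, Equiv.comp_symm_eq]
    exact eq_comm
  simp only [Matrix.of_apply, hmon]
  rw [← map_intCast (MvPolynomial.C : S →+* MvPolynomial (Fin m) S), MvPolynomial.coeff_C_mul,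
    MvPolynomial.coeff_monomial]
  simp only [hiff]

theorem order_diffProd_le (S : Type*) [CommRing S] [IsDomain S] :
    (diffProd (MvPowerSeries.X : Fin m → MvPowerSeries (Fin m) S)).order ≤
      ((∑ j : Fin m, (m - 1 - (j : ℕ)) : ℕ) : ℕ∞) := by
  classical
  rw [diffProd, MvPowerSeries.order_prod, Nat.cast_sum]
  refine Finset.sum_le_sum fun i _ => ?_
  rw [MvPowerSeries.order_prod, ← Fin.card_Ioi, Finset.card_eq_sum_ones, Nat.cast_sum]
  refine Finset.sum_le_sum fun j hj => ?_
  have hij : i ≠ j := (Finset.mem_Ioi.1 hj).ne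
  refine (MvPowerSeries.order_le (d := Finsupp.single i 1) ?_).trans ?_
  · simp [MvPowerSeries.coeff_X, Finsupp.single_left_inj, hij]
  · simp

theorem coe_diffProd (S : Type*) [CommRing S] :
    ((diffProd (MvPolynomial.X : Fin m → MvPolynomial (Fin m) S) : MvPolynomial (Fin m) S) :
      MvPowerSeries (Fin m) S) = diffProd MvPowerSeries.X := by
  rw [← MvPolynomial.coeToMvPowerSeries.ringHom_apply]
  simp only [diffProd, map_prod, map_sub, MvPolynomial.coeToMvPowerSeries.ringHom_apply,
    MvPolynomial.coe_X]

theorem degree_eq_of_comp_eq_shiftedPart {μ : YoungDiagram} (hμ : μ.colLen 0 ≤ m) {e : Fin m →₀ ℕ}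
    {σ : Perm (Fin m)} (h : e ∘ σ = shiftedPart m μ) :
    e.degree = (∑ j : Fin m, (m - 1 - (j : ℕ))) + μ.card := by
  rw [Finsupp.degree_eq_sum, ← Equiv.sum_comp σ, card_eq_sum_rowLen hμ, ← Finset.sum_add_distrib]
  refine Finset.sum_congr rfl fun j _ => ?_
  rw [add_comm]
  exact congrFun h j

/-- The Schur polynomial of `μ` has no monomials of degree less than `|μ|`, by a comparison of
the orders of the power series in `a_δ * s_μ = a_{μ+δ}`. -/
theorem coeff_schur_eq_zero (S : Type*) [CommRing S] [IsDomain S] {μ : YoungDiagram}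
    (hμ : μ.colLen 0 ≤ m) {e : Fin m →₀ ℕ} (he : e.degree < μ.card) :
    MvPolynomial.coeff e (schur S m μ) = 0 := by
  classical
  have h1 := congrArg (fun p : MvPolynomial (Fin m) S => (p : MvPowerSeries (Fin m) S).order)
    (diffProd_mul_schur S m μ hμ)
  simp only [MvPolynomial.coe_mul, MvPowerSeries.order_mul, coe_diffProd] at h1
  have h2 : (((∑ j : Fin m, (m - 1 - (j : ℕ))) + μ.card : ℕ) : ℕ∞) ≤
      (alternant S m μ : MvPowerSeries (Fin m) S).order := by
    refine MvPowerSeries.nat_le_order fun d hd => ?_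
    rw [MvPolynomial.coeff_coe, coeff_alternant]
    refine Finset.sum_eq_zero fun σ _ => ?_
    rw [if_neg, mul_zero]
    exact fun h => hd.ne (degree_eq_of_comp_eq_shiftedPart hμ h)
  rw [← h1, Nat.cast_add] at h2
  have h3 := h2.trans (add_le_add_left (order_diffProd_le S) _)
  rw [ENat.add_le_add_iff_left (ENat.natCast_ne_top _)] at h3
  rw [← MvPolynomial.coeff_coe]
  exact MvPowerSeries.coeff_of_lt_order (lt_of_lt_of_le (by exact_mod_cast he) h3)

theorem sum_range_colLen {n : ℕ} {μ : YoungDiagram} (hμ : μ.colLen 0 ≤ 2 * n) (f : ℕ → ℕ)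
    (hf : ∀ i, μ.colLen 0 ≤ 2 * i → f i = 0) :
    ∑ i ∈ Finset.range (μ.colLen 0), f i = ∑ i ∈ Finset.range n, f i := by
  have h1 : ∑ i ∈ Finset.range (μ.colLen 0), f i = ∑ i ∈ Finset.range (2 * n), f i :=
    Finset.sum_subset (Finset.range_mono hμ) fun i _ hi => hf i (by simp at hi; omega)
  have h2 : ∑ i ∈ Finset.range n, f i = ∑ i ∈ Finset.range (2 * n), f i :=
    Finset.sum_subset (Finset.range_mono (by omega)) fun i _ hi => hf i (by simp at hi; omega)
  rw [h1, h2]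

theorem sum_range_add_sub (n : ℕ) (f : ℕ → ℕ) :
    ∑ i ∈ Finset.range n, (f i + (n - 1 - i)) = (∑ i ∈ Finset.range n, f i) + n.choose 2 := by
  rw [Finset.sum_add_distrib, Finset.sum_range_reflect (fun i => i), Finset.sum_range_id,
    Nat.choose_two_right]

/-- Stanley's weight, up to a power of `abcd`, as the product of the pair weights. -/
theorem pow_mul_omega {S : Type*} [CommRing S] (a b c d : S) {n : ℕ} {μ : YoungDiagram}
    (hμ : μ.colLen 0 ≤ 2 * n) :
    (a * b * c * d) ^ n.choose 2 * omega a b c d μ =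
      ∏ k : Fin n, pairWeight a b c d (shiftedPart (2 * n) μ (fstPos k))
        (shiftedPart (2 * n) μ (sndPos k)) := by
  have hterm : ∀ k : Fin n, pairWeight a b c d (shiftedPart (2 * n) μ (fstPos k))
      (shiftedPart (2 * n) μ (sndPos k)) =
      a ^ ((μ.rowLen (2 * k) + 1) / 2 + (n - 1 - k)) * b ^ (μ.rowLen (2 * k) / 2 + (n - 1 - k)) *
      (c ^ ((μ.rowLen (2 * k + 1) + 1) / 2 + (n - 1 - k)) *
        d ^ (μ.rowLen (2 * k + 1) / 2 + (n - 1 - k))) := fun k => by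
    have hlt : shiftedPart (2 * n) μ (sndPos k) < shiftedPart (2 * n) μ (fstPos k) :=
      strictAnti_shiftedPart _ _ (by simp [fstPos, sndPos])
    have hk := k.2
    rw [pairWeight, if_pos hlt]
    simp only [shiftedPart, fstPos, sndPos]
    congr 3 <;> omega
  rw [Finset.prod_congr rfl fun k _ => hterm k]
  simp only [Finset.prod_mul_distrib, Finset.prod_pow_eq_pow_sum]
  rw [Fin.sum_univ_eq_sum_range (fun k => (μ.rowLen (2 * k) + 1) / 2 + (n - 1 - k)),
    Fin.sum_univ_eq_sum_range (fun k => μ.rowLen (2 * k) / 2 + (n - 1 - k)),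
    Fin.sum_univ_eq_sum_range (fun k => (μ.rowLen (2 * k + 1) + 1) / 2 + (n - 1 - k)),
    Fin.sum_univ_eq_sum_range (fun k => μ.rowLen (2 * k + 1) / 2 + (n - 1 - k))]
  simp only [sum_range_add_sub]
  rw [omega, sum_range_colLen hμ _ (fun i hi => by rw [rowLen_eq_zero hi]),
    sum_range_colLen hμ _ (fun i hi => by rw [rowLen_eq_zero hi]),
    sum_range_colLen hμ _ (fun i hi => by rw [rowLen_eq_zero (by omega)]),
    sum_range_colLen hμ _ (fun i hi => by rw [rowLen_eq_zero (by omega)])]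
  ring

end Alternant

/-! ### The sum of the weighted Schur polynomials -/

section Sum

variable (R : Type*) [CommRing R]

theorem diffProd_mul_zTerm {m : ℕ} {μ : YoungDiagram} (hμ : μ.colLen 0 ≤ m) :
    diffProd MvPowerSeries.X * zTerm R m μ =
      MvPowerSeries.C (omega (MvPolynomial.X 0) (MvPolynomial.X 1) (MvPolynomial.X 2)
        (MvPolynomial.X 3 : Coeffs R) μ) * (alternant (Coeffs R) m μ : Series R m) := by
  rw [zTerm, mul_left_comm, ← diffProd_mul_schur _ _ _ hμ, MvPolynomial.coe_mul, coe_diffProd]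

variable [IsDomain R]

/-- The partitions of integers at most `N` into at most `m` parts. -/
def smallDiagrams (m N : ℕ) : Finset {μ : YoungDiagram // μ.colLen 0 ≤ m} :=
  ((finite_card_le N).preimage (f := Subtype.val) Subtype.val_injective.injOn).toFinset

theorem mem_smallDiagrams {m N : ℕ} {μ : {μ : YoungDiagram // μ.colLen 0 ≤ m}} :
    μ ∈ smallDiagrams m N ↔ μ.1.card ≤ N := by
  simp [smallDiagrams]

variable {m : ℕ}

theorem coeff_zTerm_eq_zero {μ : YoungDiagram} (hμ : μ.colLen 0 ≤ m) {e : Fin m →₀ ℕ}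
    (he : e.degree < μ.card) : MvPowerSeries.coeff e (zTerm R m μ) = 0 := by
  rw [zTerm, MvPowerSeries.coeff_C_mul, MvPolynomial.coeff_coe, coeff_schur_eq_zero _ hμ he,
    mul_zero]

variable (m)

/-- The series `z`, whose coefficient at a monomial of degree `N` is a sum over the partitions of
integers at most `N`. -/
def zSeries : Series R m :=
  fun e => ∑ μ ∈ smallDiagrams m e.degree, MvPowerSeries.coeff e (zTerm R m μ)

variable {m}

theorem coeff_zSeries {N : ℕ} {e : Fin m →₀ ℕ} (he : e.degree ≤ N) :
    MvPowerSeries.coeff e (zSeries R m) =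
      ∑ μ ∈ smallDiagrams m N, MvPowerSeries.coeff e (zTerm R m μ) := by
  change ∑ μ ∈ smallDiagrams m e.degree, MvPowerSeries.coeff e (zTerm R m μ) = _
  refine Finset.sum_subset (fun μ hμ => ?_) (fun μ _ hμ => ?_)
  · rw [mem_smallDiagrams] at hμ ⊢
    omega
  · rw [mem_smallDiagrams, not_le] at hμ
    exact coeff_zTerm_eq_zero R μ.2 hμ

theorem isFormalSum_zSeries :
    IsFormalSum (fun μ : {μ : YoungDiagram // μ.colLen 0 ≤ m} => zTerm R m μ) (zSeries R m) := by
  intro e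
  have hsub : Function.support (fun μ : {μ : YoungDiagram // μ.colLen 0 ≤ m} =>
      MvPowerSeries.coeff e (zTerm R m μ)) ⊆ smallDiagrams m e.degree := by
    intro μ hμ
    rw [Finset.mem_coe, mem_smallDiagrams]
    by_contra hcon
    exact hμ (coeff_zTerm_eq_zero R μ.2 (not_le.1 hcon))
  refine ⟨(Finset.finite_toSet _).subset hsub, ?_⟩
  rw [finsum_eq_sum_of_support_subset _ hsub]
  rfl

theorem coeff_diffProd_mul_zSeries (e : Fin m →₀ ℕ) :
    MvPowerSeries.coeff e (diffProd MvPowerSeries.X * zSeries R m) =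
      ∑ μ ∈ smallDiagrams m e.degree,
        omega (MvPolynomial.X 0) (MvPolynomial.X 1) (MvPolynomial.X 2)
          (MvPolynomial.X 3 : Coeffs R) μ *
        MvPolynomial.coeff e (alternant (Coeffs R) m μ) := by
  classical
  have h1 : MvPowerSeries.coeff e (diffProd MvPowerSeries.X * zSeries R m) =
      ∑ μ ∈ smallDiagrams m e.degree,
        MvPowerSeries.coeff e (diffProd MvPowerSeries.X * zTerm R m μ) := by
    simp only [MvPowerSeries.coeff_mul]
    rw [Finset.sum_comm]
    refine Finset.sum_congr rfl fun p hp => ?_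
    have hle : p.2.degree ≤ e.degree := by
      rw [← Finset.HasAntidiagonal.mem_antidiagonal.1 hp, map_add]
      exact Nat.le_add_left _ _
    rw [coeff_zSeries R hle, Finset.mul_sum]
  rw [h1]
  refine Finset.sum_congr rfl fun μ _ => ?_
  rw [diffProd_mul_zTerm R μ.2, MvPowerSeries.coeff_C_mul, MvPolynomial.coeff_coe]

theorem exists_strictAnti_comp {e : Fin m → ℕ} (he : Function.Injective e) :
    ∃ σ : Perm (Fin m), StrictAnti (e ∘ σ) := by
  refine ⟨Fin.revPerm.trans (Tuple.sort e), fun i j hij => ?_⟩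
  have hmono : StrictMono (e ∘ Tuple.sort e) :=
    (Tuple.monotone_sort e).strictMono_of_injective (he.comp (Tuple.sort e).injective)
  exact hmono (Fin.rev_lt_rev.2 hij)

theorem perm_eq_of_strictAnti {e : Fin m → ℕ} {σ τ : Perm (Fin m)} (hσ : StrictAnti (e ∘ σ))
    (hτ : StrictAnti (e ∘ τ)) : σ = τ := by
  have hmono : StrictMono (τ.symm ∘ σ) := fun i j hij => by
    rw [← hτ.lt_iff_gt]
    simpa using hσ hij
  ext1 i
  have := fin_eq_of_strictMono hmono i
  rwa [Function.comp_apply, Equiv.symm_apply_eq] at this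

/-- The product of `(abcd)^(n choose 2)`, the difference product and `z` is a Pfaffian of power
series. -/
theorem pow_mul_diffProd_mul_zSeries (n : ℕ) :
    MvPowerSeries.C ((MvPolynomial.X 0 * MvPolynomial.X 1 * MvPolynomial.X 2 * MvPolynomial.X 3 :
        Coeffs R) ^ n.choose 2) * (diffProd MvPowerSeries.X * zSeries R (2 * n)) =
      pfaffian (Matrix.of fun i j : Fin (2 * n) => pairSeries i j
        (pairWeight (MvPolynomial.X 0) (MvPolynomial.X 1) (MvPolynomial.X 2)
          (MvPolynomial.X 3 : Coeffs R))) := by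
  classical
  ext1 e
  rw [MvPowerSeries.coeff_C_mul, coeff_diffProd_mul_zSeries, coeff_pfaffian_pairSeries,
    Finset.mul_sum]
  simp only [coeff_alternant, ← mul_assoc]
  by_cases he : Function.Injective e
  · -- A single partition and a single permutation contribute to the coefficient of the alternants.
    obtain ⟨σ, hσ⟩ := exists_strictAnti_comp he
    obtain ⟨μ, hμ, hμσ⟩ := exists_shiftedPart_eq hσ
    have hmem : (⟨μ, hμ⟩ : {μ : YoungDiagram // μ.colLen 0 ≤ 2 * n}) ∈
        smallDiagrams (2 * n) e.degree := by
      rw [mem_smallDiagrams, degree_eq_of_comp_eq_shiftedPart hμ hμσ.symm]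
      exact Nat.le_add_left _ _
    have huniq : ∀ (ν : YoungDiagram) (τ : Perm (Fin (2 * n))),
        e ∘ τ = shiftedPart (2 * n) ν → τ = σ := fun ν τ h =>
      perm_eq_of_strictAnti (h ▸ strictAnti_shiftedPart _ _) hσ
    rw [Finset.sum_eq_single_of_mem _ hmem, Finset.sum_eq_single_of_mem σ (Finset.mem_univ σ),
      if_pos hμσ.symm, mul_one, pow_mul_omega _ _ _ _ hμ, hμσ, pfaffian_pairWeight _ _ _ _ _ σ hσ,
      mul_comm]
    · rfl
    · intro τ _ hτ
      rw [if_neg fun h => hτ (huniq _ _ h), mul_zero]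
    · intro ν _ hν
      rw [Finset.sum_eq_zero, mul_zero]
      intro τ _
      rw [if_neg, mul_zero]
      intro h
      obtain rfl := huniq _ _ h
      exact hν (Subtype.ext (shiftedPart_injective ν.2 hμ (h.symm.trans hμσ.symm)))
  · rw [pfaffian_pairWeight_of_not_injective _ _ _ _ _ he]
    refine Finset.sum_eq_zero fun ν _ => ?_
    rw [Finset.sum_eq_zero, mul_zero]
    intro τ _
    rw [if_neg, mul_zero]
    intro h
    have : Function.Injective (e ∘ τ) := h ▸ (strictAnti_shiftedPart _ _).injective
    exact he ((Equiv.injective_comp τ e).1 this)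

/-- The entry `pEntry` as the generating function of the pair weights. -/
theorem pEntry_eq_pairSeries {F : Type*} [Field F] (f : MvPowerSeries (Fin m) (Coeffs R) →+* F)
    (hf : Function.Injective f) (a b c d : Coeffs R) {i j : Fin m} (hij : i ≠ j) :
    pEntry (f (MvPowerSeries.C a)) (f (MvPowerSeries.C b)) (f (MvPowerSeries.C c))
      (f (MvPowerSeries.C d)) (f (MvPowerSeries.X i)) (f (MvPowerSeries.X j)) =
      f (pairSeries i j (pairWeight a b c d)) := by
  -- The denominators have constant coefficient `1`.
  have hne : ∀ p : MvPowerSeries (Fin m) (Coeffs R), MvPowerSeries.constantCoeff p = 1 →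
      f p ≠ 0 := fun p hp h0 => by
    rw [(map_eq_zero_iff f hf).1 h0, map_zero] at hp
    exact zero_ne_one hp
  have h1 := hne (1 - MvPowerSeries.C a * MvPowerSeries.C b * MvPowerSeries.X i ^ 2) (by simp)
  have h2 := hne (1 - MvPowerSeries.C a * MvPowerSeries.C b * MvPowerSeries.X j ^ 2) (by simp)
  have h3 := hne (1 - MvPowerSeries.C a * MvPowerSeries.C b * MvPowerSeries.C c *
    MvPowerSeries.C d * MvPowerSeries.X i ^ 2 * MvPowerSeries.X j ^ 2) (by simp)
  have h := congrArg f (mul_pairSeries_pairWeight a b c d hij)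
  rw [Matrix.det_fin_two_of] at h
  simp only [map_mul, map_sub, map_add, map_pow, map_one] at h h1 h2 h3
  rw [pEntry, Matrix.det_fin_two_of, div_eq_iff (mul_ne_zero (mul_ne_zero h1 h2) h3), ← h]
  ring

end Sum

end StanleySchur

end

open StanleySchur in
theorem mainTheorem2 (R : Type*) [CommRing R] [IsDomain R] (n : ℕ) (hn : 0 < n)
    (a b c d : FractionRing (Series R (2 * n)))
    (x : Fin (2 * n) → FractionRing (Series R (2 * n)))
    (ha : a = algebraMap (Series R (2 * n)) _ (MvPowerSeries.C (MvPolynomial.X 0)))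
    (hb : b = algebraMap (Series R (2 * n)) _ (MvPowerSeries.C (MvPolynomial.X 1)))
    (hc : c = algebraMap (Series R (2 * n)) _ (MvPowerSeries.C (MvPolynomial.X 2)))
    (hd : d = algebraMap (Series R (2 * n)) _ (MvPowerSeries.C (MvPolynomial.X 3)))
    (hx : ∀ i, x i = algebraMap (Series R (2 * n)) _ (MvPowerSeries.X i)) :
    ∃ z : Series R (2 * n),
      IsFormalSum (fun μ : {μ : YoungDiagram // μ.colLen 0 ≤ 2 * n} => zTerm R (2 * n) μ) z ∧
      algebraMap (Series R (2 * n)) (FractionRing (Series R (2 * n))) z =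
        (a * b * c * d) ^ (-(n.choose 2 : ℤ)) / diffProd x *
          pfaffian (Matrix.of fun i j => pEntry a b c d (x i) (x j)) := by
  refine ⟨zSeries R (2 * n), isFormalSum_zSeries R, ?_⟩
  set f := algebraMap (Series R (2 * n)) (FractionRing (Series R (2 * n))) with hf
  have hinj : Function.Injective f := IsFractionRing.injective _ _
  have hX : ∀ k, f (MvPowerSeries.C (MvPolynomial.X k)) ≠ 0 := fun k h0 =>
    MvPolynomial.X_ne_zero (R := R) k (by
      simpa using congrArg MvPowerSeries.constantCoeff ((map_eq_zero_iff f hinj).1 h0))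
  have habcd : a * b * c * d ≠ 0 := by
    rw [ha, hb, hc, hd]
    exact mul_ne_zero (mul_ne_zero (mul_ne_zero (hX 0) (hX 1)) (hX 2)) (hX 3)
  have hxinj : Function.Injective x := fun i j hij => by
    rw [hx, hx] at hij
    exact MvPowerSeries.X_inj.1 (hinj hij)
  have hdiff : diffProd x ≠ 0 := by
    refine Finset.prod_ne_zero_iff.2 fun i _ => Finset.prod_ne_zero_iff.2 fun j hj => ?_
    exact sub_ne_zero.2 (hxinj.ne (Finset.mem_Ioi.1 hj).ne)
  have hpf : pfaffian (Matrix.of fun i j => pEntry a b c d (x i) (x j)) =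
      (a * b * c * d) ^ n.choose 2 * (diffProd x * f (zSeries R (2 * n))) := by
    have h := congrArg f (pow_mul_diffProd_mul_zSeries R n)
    rw [map_pfaffian] at h
    rw [pfaffian_congr (B := Matrix.map _ f) (fun p q hpq => ?_), ← h]
    · simp only [map_mul, map_pow, diffProd, map_prod, map_sub, ha, hb, hc, hd, hx]
    · rw [Matrix.of_apply, Matrix.map_apply, Matrix.of_apply,
        ← pEntry_eq_pairSeries R f hinj _ _ _ _ hpq.ne, ha, hb, hc, hd, hx, hx]
  rw [hpf, zpow_neg, zpow_natCast]
  have := pow_ne_zero (n.choose 2) habcd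
  field_simp
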